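/- Let $0<\varepsilon<2$, and for $x\in(0,1)$ put $$p(x)=(1-x)^{1+1/\varepsilon}(1+x)^{1-1/\varepsilon},\qquad w(x)=x^{-1}(1-x)^{1/\varepsilon}(1+x)^{-1/\varepsilon}.$$ Let $L$ be the operator $Lf=-w^{-1}(pf')'$ in the complex Hilbert space $L^2((0,1),w(x)\,dx)$, with domain $\{f\in C^\infty([0,1]) : f(0)=0\}$. Then $L$ is closable, and its closure $\bar L$ satisfies $$\operatorname{Spec}(\bar L)\subseteq(0,\infty).$$ Moreover, if $\mu\in\mathbb{C}$ is an eigenvalue of $\bar L$ and $f$ is a corresponding eigenvector with $\int_0^1|f|^2\,w\,dx=1$, then (after modification on a null set) $f\in C^\infty([0,1])$ and $f(0)=0$, and $$\mu=\int_0^1 p(x)\,|f'(x)|^2\,dx>0.$$ -/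

import Mathlib

open MeasureTheory Set
open scoped ContDiff

noncomputable section

namespace SturmLiouville

/-- The leading coefficient `p(x) = (1 - x)^(1 + 1/ε) (1 + x)^(1 - 1/ε)`. -/
def p (ε x : ℝ) : ℝ := (1 - x) ^ (1 + 1 / ε) * (1 + x) ^ (1 - 1 / ε)

/-- The weight `w(x) = x⁻¹ (1 - x)^(1/ε) (1 + x)^(-1/ε)`. -/
def w (ε x : ℝ) : ℝ := x⁻¹ * (1 - x) ^ (1 / ε) * (1 + x) ^ (-(1 / ε))

/-- The measure `w(x) dx` on the interval `(0, 1)`. -/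
def weightMeasure (ε : ℝ) : Measure ℝ :=
  (volume.restrict (Ioo (0 : ℝ) 1)).withDensity fun x => ENNReal.ofReal (w ε x)

/-- The Hilbert space `L²((0, 1), w(x) dx)` of complex-valued functions. -/
abbrev WeightedL2 (ε : ℝ) : Type := Lp ℂ 2 (weightMeasure ε)

/-- The space of functions that are smooth on `[0, 1]` (up to both end-points) and vanish at `0`.
Values outside `[0, 1]` are irrelevant. -/
def smoothZero : Submodule ℂ (ℝ → ℂ) where
  carrier := {f | ContDiffOn ℝ ∞ f (Icc 0 1) ∧ f 0 = 0}
  add_mem' := fun ha hb => ⟨ha.1.add hb.1, by simp [ha.2, hb.2]⟩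
  zero_mem' := ⟨contDiffOn_const, rfl⟩
  smul_mem' := fun c _ hf => ⟨contDiffOn_const.smul hf.1, by simp [hf.2]⟩

/-- The differential expression `-w⁻¹ (p f')'`. -/
def slExpr (ε : ℝ) (f : ℝ → ℂ) (x : ℝ) : ℂ :=
  -((w ε x : ℂ)⁻¹ * deriv (fun t => (p ε t : ℂ) * deriv f t) x)

theorem contDiffOn_Ioo {f : ℝ → ℂ} (hf : f ∈ smoothZero) : ContDiffOn ℝ ∞ f (Ioo 0 1) :=
  hf.1.mono Ioo_subset_Icc_self

theorem contDiffOn_deriv {f : ℝ → ℂ} (hf : f ∈ smoothZero) :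
    ContDiffOn ℝ ∞ (deriv f) (Ioo 0 1) :=
  (contDiffOn_Ioo hf).deriv_of_isOpen isOpen_Ioo (by simp)

theorem contDiffOn_deriv2 {f : ℝ → ℂ} (hf : f ∈ smoothZero) :
    ContDiffOn ℝ ∞ (deriv (deriv f)) (Ioo 0 1) :=
  (contDiffOn_deriv hf).deriv_of_isOpen isOpen_Ioo (by simp)

theorem differentiableAt_of_mem {f : ℝ → ℂ} (hf : f ∈ smoothZero) {x : ℝ} (hx : x ∈ Ioo (0 : ℝ) 1) :
    DifferentiableAt ℝ f x :=
  ((contDiffOn_Ioo hf).contDiffAt (isOpen_Ioo.mem_nhds hx)).differentiableAt (by simp)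

theorem differentiableAt_deriv_of_mem {f : ℝ → ℂ} (hf : f ∈ smoothZero) {x : ℝ}
    (hx : x ∈ Ioo (0 : ℝ) 1) : DifferentiableAt ℝ (deriv f) x :=
  ((contDiffOn_deriv hf).contDiffAt (isOpen_Ioo.mem_nhds hx)).differentiableAt (by simp)

theorem derivWithin_eqOn (f : ℝ → ℂ) {x : ℝ} (hx : x ∈ Ioo (0 : ℝ) 1) :
    derivWithin f (Icc 0 1) x = deriv f x :=
  derivWithin_of_mem_nhds (Icc_mem_nhds hx.1 hx.2)

theorem bounded_deriv {f : ℝ → ℂ} (hf : f ∈ smoothZero) :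
    ∃ C, ∀ x ∈ Ioo (0 : ℝ) 1, ‖deriv f x‖ ≤ C := by
  have h1 : ContDiffOn ℝ ∞ (derivWithin f (Icc 0 1)) (Icc 0 1) :=
    hf.1.derivWithin (uniqueDiffOn_Icc one_pos) (by simp)
  obtain ⟨C, hC⟩ := isCompact_Icc.exists_bound_of_continuousOn h1.continuousOn
  refine ⟨C, fun x hx => ?_⟩
  rw [← derivWithin_eqOn f hx]
  exact hC x (Ioo_subset_Icc_self hx)

theorem bounded_deriv2 {f : ℝ → ℂ} (hf : f ∈ smoothZero) :
    ∃ C, ∀ x ∈ Ioo (0 : ℝ) 1, ‖deriv (deriv f) x‖ ≤ C := by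
  have h1 : ContDiffOn ℝ ∞ (derivWithin f (Icc 0 1)) (Icc 0 1) :=
    hf.1.derivWithin (uniqueDiffOn_Icc one_pos) (by simp)
  have h2 : ContDiffOn ℝ ∞ (derivWithin (derivWithin f (Icc 0 1)) (Icc 0 1)) (Icc 0 1) :=
    h1.derivWithin (uniqueDiffOn_Icc one_pos) (by simp)
  obtain ⟨C, hC⟩ := isCompact_Icc.exists_bound_of_continuousOn h2.continuousOn
  refine ⟨C, fun x hx => ?_⟩
  have h3 : deriv f =ᶠ[nhds x] derivWithin f (Icc 0 1) :=
    Filter.eventually_of_mem (isOpen_Ioo.mem_nhds hx) fun y hy => (derivWithin_eqOn f hy).symm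
  rw [h3.deriv_eq, ← derivWithin_eqOn _ hx]
  exact hC x (Ioo_subset_Icc_self hx)

theorem bounded_self {f : ℝ → ℂ} (hf : f ∈ smoothZero) :
    ∃ C, ∀ x ∈ Ioo (0 : ℝ) 1, ‖f x‖ ≤ C * x := by
  have h1 : ContDiffOn ℝ ∞ (derivWithin f (Icc 0 1)) (Icc 0 1) :=
    hf.1.derivWithin (uniqueDiffOn_Icc one_pos) (by simp)
  obtain ⟨C, hC⟩ := isCompact_Icc.exists_bound_of_continuousOn h1.continuousOn
  refine ⟨C, fun x hx => ?_⟩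
  have h := (convex_Icc (0 : ℝ) 1).norm_image_sub_le_of_norm_derivWithin_le
    (hf.1.differentiableOn (by simp)) hC (left_mem_Icc.2 zero_le_one) (Ioo_subset_Icc_self hx)
  simpa [hf.2, abs_of_pos hx.1] using h

/-- On `(0, 1)`, `-w⁻¹ (p f')' = -x (1 - x²) f'' + 2 x (x + 1/ε) f'` for smooth `f`. -/
theorem slExpr_eq (ε : ℝ) {f : ℝ → ℂ} (hf : f ∈ smoothZero) {x : ℝ} (hx : x ∈ Ioo (0 : ℝ) 1) :
    slExpr ε f x = -((x * (1 - x ^ 2) : ℝ) : ℂ) * deriv (deriv f) x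
      + ((2 * x * (x + 1 / ε) : ℝ) : ℂ) * deriv f x := by
  obtain ⟨h0, h1⟩ := hx
  have hm : 0 < 1 - x := by linarith
  have hp : 0 < 1 + x := by linarith
  set a := 1 / ε with ha
  have d1 : HasDerivAt (fun t : ℝ => (1 - t) ^ (1 + a)) (-(1 + a) * (1 - x) ^ a) x := by
    have := ((hasDerivAt_id x).const_sub 1).rpow_const (p := 1 + a) (Or.inl hm.ne')
    convert this using 1
    · rfl
    · rw [add_sub_cancel_left, id, neg_one_mul]
  have d2 : HasDerivAt (fun t : ℝ => (1 + t) ^ (1 - a)) ((1 - a) * (1 + x) ^ (-a)) x := by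
    have := ((hasDerivAt_id x).const_add 1).rpow_const (p := 1 - a) (Or.inl hp.ne')
    convert this using 1
    · rfl
    · rw [sub_sub_cancel_left, id, one_mul]
  have dp : HasDerivAt (p ε) (-(1 + a) * (1 - x) ^ a * (1 + x) ^ (1 - a)
      + (1 - x) ^ (1 + a) * ((1 - a) * (1 + x) ^ (-a))) x := d1.mul d2
  have df := (differentiableAt_deriv_of_mem hf ⟨h0, h1⟩).hasDerivAt
  have dd := dp.ofReal_comp.mul df
  have e1 : (1 - x) ^ (1 + a) = (1 - x) * (1 - x) ^ a := by rw [Real.rpow_add hm, Real.rpow_one]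
  have e2 : (1 + x) ^ (1 - a) = (1 + x) * (1 + x) ^ (-a) := by
    rw [sub_eq_add_neg, Real.rpow_add hp, Real.rpow_one]
  have hA : (1 - x) ^ a ≠ 0 := (Real.rpow_pos_of_pos hm _).ne'
  have hB : (1 + x) ^ (-a) ≠ 0 := (Real.rpow_pos_of_pos hp _).ne'
  have k1 : (w ε x)⁻¹ * p ε x = x * (1 - x ^ 2) := by
    simp only [w, p, ← ha, e1, e2]
    field_simp
    ring
  have k2 : (w ε x)⁻¹ * (-(1 + a) * (1 - x) ^ a * (1 + x) ^ (1 - a)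
      + (1 - x) ^ (1 + a) * ((1 - a) * (1 + x) ^ (-a))) = -(2 * x * (x + a)) := by
    simp only [w, ← ha, e1, e2]
    field_simp
    ring
  have hd : deriv (fun t => (p ε t : ℂ) * deriv f t) x = _ := dd.deriv
  rw [slExpr, hd, mul_add, ← mul_assoc _ _ (deriv f x), ← mul_assoc _ _ (deriv (deriv f) x),
    ← Complex.ofReal_inv, ← Complex.ofReal_mul, ← Complex.ofReal_mul, k1, k2]
  push_cast
  ring

theorem ae_weightMeasure {ε : ℝ} {P : ℝ → Prop} (h : ∀ x ∈ Ioo (0 : ℝ) 1, P x) :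
    ∀ᵐ x ∂(weightMeasure ε), P x :=
  (withDensity_absolutelyContinuous _ _).ae_le (ae_restrict_of_forall_mem measurableSet_Ioo h)

theorem measurable_w (ε : ℝ) : Measurable (w ε) := by
  unfold w
  fun_prop

theorem w_pos {ε x : ℝ} (hx : x ∈ Ioo (0 : ℝ) 1) : 0 < w ε x := by
  have h1 : 0 < 1 - x := by linarith [hx.2]
  have h2 : 0 < 1 + x := by linarith [hx.1]
  have := hx.1
  unfold w
  positivity

theorem w_mul_le {ε : ℝ} (hε : 0 < ε) {x : ℝ} (hx : x ∈ Ioo (0 : ℝ) 1) : w ε x * x ≤ 1 := by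
  have h1 : 0 < 1 - x := by linarith [hx.2]
  have h2 : 0 < 1 + x := by linarith [hx.1]
  have ha : 0 < 1 / ε := by positivity
  have b1 : (1 - x) ^ (1 / ε) ≤ 1 := Real.rpow_le_one h1.le (by linarith [hx.1]) ha.le
  have b2 : (1 + x) ^ (-(1 / ε)) ≤ 1 :=
    Real.rpow_le_one_of_one_le_of_nonpos (by linarith [hx.1]) (by linarith)
  have e : w ε x * x = (1 - x) ^ (1 / ε) * (1 + x) ^ (-(1 / ε)) := by
    have := hx.1.ne'
    unfold w
    field_simp
  rw [e]
  exact mul_le_one₀ b1 (by positivity) b2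

/-- A continuous function on `(0, 1)` which is `O(x)` belongs to `L²((0, 1), w(x) dx)`. -/
theorem memLp_of_bound {ε : ℝ} (hε : 0 < ε) {g : ℝ → ℂ} (hg : ContinuousOn g (Ioo 0 1)) {C : ℝ}
    (hC : ∀ x ∈ Ioo (0 : ℝ) 1, ‖g x‖ ≤ C * x) : MemLp g 2 (weightMeasure ε) := by
  have hm : AEStronglyMeasurable g (volume.restrict (Ioo (0 : ℝ) 1)) :=
    hg.aestronglyMeasurable measurableSet_Ioo
  have hm' : AEStronglyMeasurable g (weightMeasure ε) :=
    hm.mono_ac (withDensity_absolutelyContinuous _ _)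
  rw [memLp_two_iff_integrable_sq_norm hm', weightMeasure,
    integrable_withDensity_iff (measurable_w ε).ennreal_ofReal (by simp)]
  have hfin : IntegrableOn (fun _ : ℝ => C ^ 2) (Ioo (0 : ℝ) 1) := integrableOn_const (by simp)
  refine Integrable.mono' hfin ?_ (ae_restrict_of_forall_mem measurableSet_Ioo fun x hx => ?_)
  · exact (hm.norm.pow 2).mul
      (measurable_w ε).ennreal_ofReal.ennreal_toReal.aestronglyMeasurable
  · have hw := w_pos (ε := ε) hx
    have h1 : ‖g x‖ ^ 2 ≤ (C * x) ^ 2 := by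
      have := hC x hx
      gcongr
    rw [ENNReal.toReal_ofReal hw.le, Real.norm_of_nonneg (by positivity)]
    have h2 := w_mul_le hε hx
    have hx0 := hx.1
    have hx1 := hx.2
    calc ‖g x‖ ^ 2 * w ε x ≤ (C * x) ^ 2 * w ε x := by gcongr
      _ = C ^ 2 * (x * (w ε x * x)) := by ring
      _ ≤ C ^ 2 * (1 * 1) := by gcongr
      _ = C ^ 2 := by ring

theorem memLp_self {ε : ℝ} (hε : 0 < ε) {f : ℝ → ℂ} (hf : f ∈ smoothZero) :
    MemLp f 2 (weightMeasure ε) := by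
  obtain ⟨C, hC⟩ := bounded_self hf
  exact memLp_of_bound hε (contDiffOn_Ioo hf).continuousOn hC

theorem memLp_slExpr {ε : ℝ} (hε : 0 < ε) {f : ℝ → ℂ} (hf : f ∈ smoothZero) :
    MemLp (slExpr ε f) 2 (weightMeasure ε) := by
  obtain ⟨C₁, h₁⟩ := bounded_deriv hf
  obtain ⟨C₂, h₂⟩ := bounded_deriv2 hf
  have hc : ContinuousOn (slExpr ε f) (Ioo 0 1) := by
    refine ContinuousOn.congr ?_ fun x hx => slExpr_eq ε hf hx
    have c1 := (contDiffOn_deriv hf).continuousOn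
    have c2 := (contDiffOn_deriv2 hf).continuousOn
    refine ContinuousOn.add (ContinuousOn.mul ?_ c2) (ContinuousOn.mul ?_ c1)
    · exact (by fun_prop : Continuous _).continuousOn
    · exact (by fun_prop : Continuous _).continuousOn
  refine memLp_of_bound hε (C := C₂ + 2 * (1 + 1 / ε) * C₁) hc fun x hx => ?_
  rw [slExpr_eq ε hf hx]
  have hx0 := hx.1
  have hx1 := hx.2
  have ha : 0 < 1 / ε := by positivity
  have hs : 0 ≤ 1 - x ^ 2 := by nlinarith
  have n1 : ‖-((x * (1 - x ^ 2) : ℝ) : ℂ)‖ = x * (1 - x ^ 2) := by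
    rw [norm_neg, Complex.norm_real, Real.norm_of_nonneg (by positivity)]
  have n2 : ‖((2 * x * (x + 1 / ε) : ℝ) : ℂ)‖ = 2 * x * (x + 1 / ε) := by
    rw [Complex.norm_real, Real.norm_of_nonneg (by positivity)]
  refine (norm_add_le _ _).trans ?_
  rw [norm_mul, norm_mul, n1, n2]
  have b1 : x * (1 - x ^ 2) ≤ x * 1 := by
    gcongr
    nlinarith
  have b2 : 2 * x * (x + 1 / ε) ≤ 2 * x * (1 + 1 / ε) := by gcongr
  calc x * (1 - x ^ 2) * ‖deriv (deriv f) x‖ + 2 * x * (x + 1 / ε) * ‖deriv f x‖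
      ≤ x * 1 * C₂ + 2 * x * (1 + 1 / ε) * C₁ := by
        have := h₁ x hx
        have := h₂ x hx
        gcongr
    _ = (C₂ + 2 * (1 + 1 / ε) * C₁) * x := by ring

/-- The class in `L²((0, 1), w(x) dx)` of a smooth function vanishing at `0`. -/
def toL2 {ε : ℝ} (hε : 0 < ε) : smoothZero →ₗ[ℂ] WeightedL2 ε where
  toFun f := (memLp_self hε f.2).toLp f
  map_add' f g := MemLp.toLp_add (memLp_self hε f.2) (memLp_self hε g.2)
  map_smul' c f := MemLp.toLp_const_smul c (memLp_self hε f.2)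

/-- The class in `L²((0, 1), w(x) dx)` of `-w⁻¹ (p f')'`. -/
def slL2 {ε : ℝ} (hε : 0 < ε) : smoothZero →ₗ[ℂ] WeightedL2 ε where
  toFun f := (memLp_slExpr hε f.2).toLp (slExpr ε f)
  map_add' f g := by
    rw [← MemLp.toLp_add, MemLp.toLp_eq_toLp_iff]
    refine ae_weightMeasure fun x hx => ?_
    have hd : deriv ((f + g : smoothZero) : ℝ → ℂ) =ᶠ[nhds x] deriv f + deriv g :=
      Filter.eventually_of_mem (isOpen_Ioo.mem_nhds hx) fun y hy =>
        deriv_add (differentiableAt_of_mem f.2 hy) (differentiableAt_of_mem g.2 hy)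
    rw [Pi.add_apply, slExpr_eq ε (f + g).2 hx, slExpr_eq ε f.2 hx, slExpr_eq ε g.2 hx,
      hd.deriv_eq, hd.self_of_nhds, deriv_add (differentiableAt_deriv_of_mem f.2 hx)
        (differentiableAt_deriv_of_mem g.2 hx), Pi.add_apply]
    ring
  map_smul' c f := by
    rw [RingHom.id_apply, ← MemLp.toLp_const_smul, MemLp.toLp_eq_toLp_iff]
    refine ae_weightMeasure fun x hx => ?_
    have hd : deriv ((c • f : smoothZero) : ℝ → ℂ) =ᶠ[nhds x] c • deriv f :=
      Filter.eventually_of_mem (isOpen_Ioo.mem_nhds hx) fun y hy =>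
        deriv_const_smul c (differentiableAt_of_mem f.2 hy)
    rw [Pi.smul_apply, slExpr_eq ε (c • f).2 hx, slExpr_eq ε f.2 hx,
      hd.deriv_eq, hd.self_of_nhds, deriv_const_smul c (differentiableAt_deriv_of_mem f.2 hx),
      Pi.smul_apply, smul_eq_mul, smul_eq_mul, smul_eq_mul]
    ring

theorem ae_volume_of_ae_weightMeasure {ε : ℝ} {P : ℝ → Prop} (h : ∀ᵐ x ∂(weightMeasure ε), P x) :
    ∀ᵐ x ∂(volume.restrict (Ioo (0 : ℝ) 1)), P x := by
  rw [weightMeasure, ae_withDensity_iff (measurable_w ε).ennreal_ofReal] at h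
  filter_upwards [h, ae_restrict_mem measurableSet_Ioo] with x hx hmem
  exact hx (by simpa using w_pos hmem)

/-- `-w⁻¹ (p f')'` depends only on the class of `f` in `L²((0, 1), w(x) dx)`. -/
theorem ker_toL2_le {ε : ℝ} (hε : 0 < ε) :
    LinearMap.ker (toL2 hε) ≤ LinearMap.ker (slL2 hε) := by
  intro f hf
  rw [LinearMap.mem_ker] at hf ⊢
  have h0 : (f : ℝ → ℂ) =ᵐ[weightMeasure ε] 0 := by
    have h := (memLp_self hε f.2).coeFn_toLp
    have hz : (memLp_self hε f.2).toLp (f : ℝ → ℂ) = 0 := hf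
    rw [hz] at h
    exact h.symm.trans (Lp.coeFn_zero _ _ _)
  have h1 : EqOn (f : ℝ → ℂ) 0 (Ioo 0 1) :=
    Measure.eqOn_open_of_ae_eq (ae_volume_of_ae_weightMeasure h0) isOpen_Ioo
      (contDiffOn_Ioo f.2).continuousOn continuousOn_const
  have hd : ∀ x ∈ Ioo (0 : ℝ) 1, deriv (f : ℝ → ℂ) x = 0 := fun x hx => by
    rw [(h1.eventuallyEq_of_mem (isOpen_Ioo.mem_nhds hx)).deriv_eq]
    simp
  have hd2 : ∀ x ∈ Ioo (0 : ℝ) 1, deriv (deriv (f : ℝ → ℂ)) x = 0 := fun x hx => by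
    have : deriv (f : ℝ → ℂ) =ᶠ[nhds x] 0 :=
      Filter.eventually_of_mem (isOpen_Ioo.mem_nhds hx) hd
    rw [this.deriv_eq]
    simp
  have h2 : slExpr ε f =ᵐ[weightMeasure ε] (fun _ => (0 : ℂ)) :=
    ae_weightMeasure fun x hx => by rw [slExpr_eq ε f.2 hx, hd x hx, hd2 x hx]; simp
  have h3 : (memLp_slExpr hε f.2).toLp (slExpr ε f) = 0 := by
    refine Lp.ext ?_
    exact ((memLp_slExpr hε f.2).coeFn_toLp.trans h2).trans (Lp.coeFn_zero _ _ _).symm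
  exact h3

/-- The Sturm-Liouville operator `L f = -w⁻¹ (p f')'` in `L²((0, 1), w(x) dx)`, with domain the
(classes of) smooth functions on `[0, 1]` that vanish at `0`. -/
def opL {ε : ℝ} (hε : 0 < ε) : WeightedL2 ε →ₗ.[ℂ] WeightedL2 ε where
  domain := LinearMap.range (toL2 hε)
  toFun := ((LinearMap.ker (toL2 hε)).liftQ (slL2 hε) (ker_toL2_le hε)).comp
    (toL2 hε).quotKerEquivRange.symm.toLinearMap

theorem opL_apply {ε : ℝ} (hε : 0 < ε) (f : smoothZero) :
    opL hε ⟨toL2 hε f, LinearMap.mem_range_self _ f⟩ = slL2 hε f := by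
  have h : (toL2 hε).quotKerEquivRange.symm ⟨toL2 hε f, LinearMap.mem_range_self _ f⟩ =
      Submodule.Quotient.mk f := by
    rw [LinearEquiv.symm_apply_eq]
    rfl
  exact (congrArg ((LinearMap.ker (toL2 hε)).liftQ (slL2 hε) (ker_toL2_le hε)) h).trans
    (Submodule.liftQ_apply _ _ _)

/-- The resolvent set of an unbounded operator `T`: all `z` such that `T - z` maps its domain
bijectively onto the whole space, with bounded inverse. -/
def resolventSet {E : Type*} [NormedAddCommGroup E] [NormedSpace ℂ E] (T : E →ₗ.[ℂ] E) : Set ℂ :=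
  {z | ∃ R : E →L[ℂ] E,
    (∀ y : E, ∃ x : T.domain, (x : E) = R y ∧ T x - z • (x : E) = y) ∧
    ∀ x : T.domain, R (T x - z • (x : E)) = x}

/-- The spectrum of an unbounded operator. -/
def spec {E : Type*} [NormedAddCommGroup E] [NormedSpace ℂ E] (T : E →ₗ.[ℂ] E) : Set ℂ :=
  (resolventSet T)ᶜ

end SturmLiouville

end

/-! The operator has a bounded positive inverse `G`, and everything is read off from `G`.
Integration by parts, with boundary terms killed by `f 0 = 0` and `p ε 1 = 0`, gives `⟨L f, f⟩ = ∫ p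
|f'|²` (`inner_slL2_toL2`). Let `P` be the primitive of `1 / p` vanishing at `0`. Cauchy-Schwarz
gives `|f|² ≤ P ∫ p |f'|²`, and since `w P` is bounded this yields a Poincaré inequality
(`exists_norm_toL2_sq_le`), hence `‖f‖ ≤ C ‖L f‖`. The equation `L f = g` is solved explicitly for
smooth `g` vanishing at `0`, so the range of `L` is dense and `L f ↦ f` extends to a bounded `G`
(`exists_green`). By density `G` is positive; being symmetric with dense range, it is injective.
Therefore `L` is closable with closure `G⁻¹`, and since the spectrum of `G` lies in `[0, ∞)`, that
of the closure lies in `(0, ∞)`.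

An eigenvector satisfies `u = μ G u`, and the remaining work is its smoothness up to both singular
end-points. `G` is integration against the kernel `P(min(x, y))` with weight `w`
(`ae_eq_integral_kern`), so `|u| ≤ C P^(1/2)` to begin with. The integral equation lowers this
exponent in finitely many steps until `u` is bounded (`exists_bound`). Then `u = x v` with `v`
continuous on `[0, 1]`, and `v = μ • divGreen v`, where `divGreen` composes an average based at `0`
with one based at `1`. An average preserves `C^k` at its base point and gains a derivative away from
it; the base points differ, so the composite gains a derivative everywhere and `v` is smooth
(`exists_contDiffOn_of_integral_eq`). The eigenvalue formula is then the Dirichlet identity, and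
strict positivity is the Poincaré inequality. -/

noncomputable section

namespace SturmLiouville

/-! ### Weighted averages: smoothness at and away from the base point -/

/-- The weighted average `∫₀¹ s ^ b H(s x) ds`. -/
def avg (b : ℝ) (H : ℝ → ℂ) (x : ℝ) : ℂ := ∫ s in (0 : ℝ)..1, (s ^ b) • H (s * x)

theorem avg_congr {b : ℝ} {H K : ℝ → ℂ} {r x : ℝ} (h : EqOn H K (Icc 0 r)) (hx : x ∈ Icc 0 r) :
    avg b H x = avg b K x := by
  refine intervalIntegral.integral_congr fun s hs => ?_
  rw [uIcc_of_le zero_le_one] at hs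
  have : s * x ∈ Icc 0 r :=
    ⟨mul_nonneg hs.1 hx.1, (mul_le_of_le_one_left hx.1 hs.2).trans hx.2⟩
  simp only [h this]

theorem continuous_avg {b : ℝ} (hb : 0 ≤ b) {H : ℝ → ℂ} (hH : Continuous H) :
    Continuous (avg b H) := by
  have h := Real.continuous_rpow_const hb
  refine intervalIntegral.continuous_parametric_intervalIntegral_of_continuous' ?_ 0 1
  exact (h.comp continuous_snd).smul (hH.comp (continuous_snd.mul continuous_fst))

/-- Differentiation under the integral: the chain rule produces a factor `s`, which raises the
exponent by one. This holds at the base point `0` too, but costs a derivative of `H`. -/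
theorem hasDerivAt_avg {b : ℝ} (hb : 0 ≤ b) {H : ℝ → ℂ} (hH : ContDiff ℝ 1 H) (x : ℝ) :
    HasDerivAt (avg b H) (avg (b + 1) (deriv H) x) x := by
  have hc := Real.continuous_rpow_const hb
  have hd : Continuous (deriv H) := hH.continuous_deriv (by simp)
  have hHd : Differentiable ℝ H := hH.differentiable (by simp)
  obtain ⟨C, hC⟩ := (isCompact_Icc (a := -(|x| + 1)) (b := |x| + 1)).exists_bound_of_continuousOn
    hd.continuousOn
  have key := intervalIntegral.hasDerivAt_integral_of_dominated_loc_of_deriv_le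
    (F := fun x s => (s ^ b) • H (s * x)) (F' := fun x s => (s ^ b) • (s • deriv H (s * x)))
    (bound := fun _ => C) (a := 0) (b := 1) (μ := volume) (x₀ := x) (Metric.ball_mem_nhds x one_pos)
    (Filter.Eventually.of_forall fun y => (hc.smul
      (hH.continuous.comp (continuous_id.mul continuous_const))).aestronglyMeasurable)
    ((hc.smul (hH.continuous.comp (continuous_id.mul continuous_const))).intervalIntegrable _ _)
    ((hc.smul (continuous_id.smul
      (hd.comp (continuous_id.mul continuous_const)))).aestronglyMeasurable)
    (Filter.Eventually.of_forall fun s hs y hy => ?_) (by simp)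
    (Filter.Eventually.of_forall fun s hs y hy => ?_)
  · have := key.2
    refine this.congr_deriv (intervalIntegral.integral_congr fun s hs => ?_)
    rw [uIcc_of_le zero_le_one] at hs
    simp only [smul_smul]
    rcases hs.1.eq_or_lt with rfl | h0
    -- At `s = 0` both sides vanish, even for `b = 0` where `0 ^ b = 1`, because of the extra factor
    -- `s`.
    · simp [Real.zero_rpow (by linarith : b + 1 ≠ 0)]
    · rw [Real.rpow_add h0, Real.rpow_one]
  · rw [uIoc_of_le zero_le_one] at hs
    have hy' : |y| ≤ |x| + 1 := by
      rw [Metric.mem_ball, Real.dist_eq] at hy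
      have := abs_sub_abs_le_abs_sub y x
      linarith
    have h1 : |s * y| ≤ |x| + 1 := by
      rw [abs_mul, abs_of_pos hs.1]
      nlinarith [abs_nonneg y, hs.2, hs.1]
    have h2 := hC (s * y) (abs_le.1 h1)
    rw [norm_smul, norm_smul, Real.norm_of_nonneg (Real.rpow_nonneg hs.1.le _),
      Real.norm_of_nonneg hs.1.le]
    have h3 : s ^ b ≤ 1 := Real.rpow_le_one hs.1.le hs.2 hb
    have h4 := Real.rpow_nonneg hs.1.le b
    calc s ^ b * (s * ‖deriv H (s * y)‖) ≤ 1 * (1 * C) := by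
          have := hs.1.le
          gcongr
          exact hs.2
      _ = C := by ring
  · have h1 : HasDerivAt (fun y : ℝ => s * y) s y := by
      simpa using (hasDerivAt_id y).const_mul s
    exact ((hHd (s * y)).hasDerivAt.scomp y h1).const_smul (s ^ b)

theorem contDiff_avg (k : ℕ) {b : ℝ} (hb : 0 ≤ b) {H : ℝ → ℂ} (hH : ContDiff ℝ k H) :
    ContDiff ℝ k (avg b H) := by
  induction k generalizing b H with
  | zero => exact contDiff_zero.2 (continuous_avg hb (contDiff_zero.1 hH))
  | succ k ih =>
    have h1 : ContDiff ℝ 1 H := hH.of_le (by exact_mod_cast Nat.le_add_left 1 k)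
    have hH' : ContDiff ℝ ((k : WithTop ℕ∞) + 1) H := by exact_mod_cast hH
    push_cast
    refine contDiff_succ_iff_deriv.2
      ⟨fun x => (hasDerivAt_avg hb h1 x).differentiableAt, by simp, ?_⟩
    rw [show deriv (avg b H) = avg (b + 1) (deriv H) from
      funext fun x => (hasDerivAt_avg hb h1 x).deriv]
    exact ih (by linarith) (contDiff_succ_iff_deriv.1 hH').2.2

theorem rpow_mul_avg {b : ℝ} (H : ℝ → ℂ) {x : ℝ} (hx : 0 < x) :
    (x ^ (b + 1)) • avg b H x = ∫ t in (0 : ℝ)..x, (t ^ b) • H t := by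
  have h := intervalIntegral.smul_integral_comp_mul_right (a := 0) (b := 1)
    (fun t => (t ^ b) • H t) x
  simp only [zero_mul, one_mul] at h
  rw [← h, Real.rpow_add hx, Real.rpow_one, mul_comm, mul_smul]
  congr 1
  rw [avg, ← intervalIntegral.integral_smul]
  refine intervalIntegral.integral_congr fun s hs => ?_
  rw [uIcc_of_le zero_le_one] at hs
  simp only [smul_smul]
  rw [Real.mul_rpow hs.1 hx.le, mul_comm]

/-- Differentiating `x ^ (b + 1) • avg b H x = ∫₀ˣ t ^ b • H t` expresses the derivative through `H`
and its average alone. Hence an average is one order smoother than `H` away from `0`. -/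
theorem hasDerivAt_avg_of_pos {b : ℝ} (hb : 0 ≤ b) {H : ℝ → ℂ} (hH : Continuous H) {x : ℝ}
    (hx : 0 < x) : HasDerivAt (avg b H) (x⁻¹ • (H x - (b + 1) • avg b H x)) x := by
  have hc : Continuous fun t : ℝ => (t ^ b) • H t := (Real.continuous_rpow_const hb).smul hH
  have h1 := (hc.integral_hasStrictDerivAt 0 x).hasDerivAt
  have h2 := Real.hasDerivAt_rpow_const (x := x) (p := -(b + 1)) (Or.inl hx.ne')
  have h3 := h2.smul h1
  have e : avg b H =ᶠ[nhds x] fun y => (y ^ (-(b + 1))) • ∫ t in (0 : ℝ)..y, (t ^ b) • H t := by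
    filter_upwards [lt_mem_nhds hx] with y hy
    rw [← rpow_mul_avg H hy, smul_smul, ← Real.rpow_add hy, neg_add_cancel, Real.rpow_zero,
      one_smul]
  refine (h3.congr_of_eventuallyEq e).congr_deriv ?_
  rw [← rpow_mul_avg H hx, smul_smul, smul_smul, mul_assoc, ← Real.rpow_add hx,
    ← Real.rpow_add hx, smul_sub, smul_smul]
  have e1 : -(b + 1) + b = -1 := by ring
  have e2 : -(b + 1) - 1 + (b + 1) = -1 := by ring
  rw [e1, e2, Real.rpow_neg_one, mul_comm, mul_neg, neg_smul, ← sub_eq_add_neg]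

theorem contDiffOn_avg_Ioi (k : ℕ) {b : ℝ} (hb : 0 ≤ b) {H : ℝ → ℂ} (hH : ContDiff ℝ k H) :
    ContDiffOn ℝ (k + 1 : ℕ) (avg b H) (Ioi 0) := by
  push_cast
  refine (contDiffOn_succ_iff_deriv_of_isOpen isOpen_Ioi).2
    ⟨fun x hx => (hasDerivAt_avg_of_pos hb hH.continuous hx).differentiableAt.differentiableWithinAt,
      by simp, ?_⟩
  have h : ContDiffOn ℝ k (fun x => x⁻¹ • (H x - (b + 1) • avg b H x)) (Ioi 0) :=
    ((contDiffOn_id (s := Ioi (0 : ℝ))).inv fun x hx => (ne_of_gt hx)).smul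
      (hH.sub ((contDiff_avg k hb hH).const_smul (b + 1))).contDiffOn
  exact h.congr fun x hx => (hasDerivAt_avg_of_pos hb hH.continuous hx).deriv

/-- A `C^k` function on `[0, r]` extends to a `C^k` function on the line. -/
theorem exists_contDiff_extension (k : ℕ) {r : ℝ} (hr : 0 < r) {f : ℝ → ℂ}
    (hf : ContDiffOn ℝ k f (Icc 0 r)) : ∃ g : ℝ → ℂ, ContDiff ℝ k g ∧ EqOn f g (Icc 0 r) := by
  induction k generalizing f with
  | zero =>
    have hc : ContinuousOn f (Icc 0 r) := contDiffOn_zero.1 hf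
    refine ⟨IccExtend hr.le ((Icc 0 r).domRestrict f), contDiff_zero.2
      (continuousOn_iff_continuous_domRestrict.1 hc).Icc_extend', fun x hx => ?_⟩
    rw [IccExtend_of_mem _ _ hx, domRestrict_apply]
  | succ k ih =>
    have hu := uniqueDiffOn_Icc hr
    have hf' : ContDiffOn ℝ ((k : WithTop ℕ∞) + 1) f (Icc 0 r) := by exact_mod_cast hf
    obtain ⟨hd, -, hk⟩ := (contDiffOn_succ_iff_derivWithin hu).1 hf'
    obtain ⟨g, hg, he⟩ := ih hk
    -- Extend the derivative by induction, then integrate it back.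
    have hG : ∀ x, HasDerivAt (fun x => f 0 + ∫ t in (0 : ℝ)..x, g t) (g x) x := fun x =>
      ((hg.continuous.integral_hasStrictDerivAt 0 x).hasDerivAt).const_add _
    refine ⟨fun x => f 0 + ∫ t in (0 : ℝ)..x, g t, ?_, fun x hx => ?_⟩
    · push_cast
      refine contDiff_succ_iff_deriv.2 ⟨fun x => (hG x).differentiableAt, by simp, ?_⟩
      rwa [show deriv (fun x => f 0 + ∫ t in (0 : ℝ)..x, g t) = g from
        funext fun x => (hG x).deriv]
    · have h := intervalIntegral.integral_eq_sub_of_hasDerivAt_of_le hx.1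
        (hd.continuousOn.mono (Icc_subset_Icc_right hx.2)) (f' := g) (fun y hy => ?_)
        (hg.continuous.intervalIntegrable _ _)
      · simp [h]
      · have hy' : y ∈ Icc 0 r := ⟨hy.1.le, hy.2.le.trans hx.2⟩
        rw [← he hy']
        exact (hd y hy').hasDerivWithinAt.hasDerivAt
          (Icc_mem_nhds hy.1 (hy.2.trans_le hx.2))

theorem contDiffOn_avg (k : ℕ) {b r : ℝ} (hb : 0 ≤ b) (hr : 0 < r) {H : ℝ → ℂ}
    (hH : ContDiffOn ℝ k H (Icc 0 r)) : ContDiffOn ℝ k (avg b H) (Icc 0 r) := by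
  obtain ⟨g, hg, he⟩ := exists_contDiff_extension k hr hH
  exact (contDiff_avg k hb hg).contDiffOn.congr fun x hx => avg_congr he hx

theorem contDiffOn_avg_succ (k : ℕ) {b r : ℝ} (hb : 0 ≤ b) (hr : 0 < r) {H : ℝ → ℂ}
    (hH : ContDiffOn ℝ k H (Icc 0 r)) : ContDiffOn ℝ (k + 1 : ℕ) (avg b H) (Ioc 0 r) := by
  obtain ⟨g, hg, he⟩ := exists_contDiff_extension k hr hH
  exact ((contDiffOn_avg_Ioi k hb hg).mono fun x hx => hx.1).congr
    fun x hx => avg_congr he (Ioc_subset_Icc_self hx)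

/-! ### Averages based at `1` and the smoothing solution operator -/

/-- The average `∫₀¹ s ^ a H(1 - s (1 - x)) ds`, based at the end-point `1`. -/
def avgOne (a : ℝ) (H : ℝ → ℂ) (x : ℝ) : ℂ := avg a (fun t => H (1 - t)) (1 - x)

theorem contDiffOn_comp_one_sub {n : WithTop ℕ∞} {H : ℝ → ℂ} {s t : Set ℝ}
    (hH : ContDiffOn ℝ n H s) (hst : ∀ x ∈ t, 1 - x ∈ s) :
    ContDiffOn ℝ n (fun x => H (1 - x)) t :=
  hH.comp (contDiff_const.sub contDiff_id).contDiffOn hst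

theorem contDiffOn_avgOne (k : ℕ) {a : ℝ} (ha : 0 ≤ a) {H : ℝ → ℂ}
    (hH : ContDiffOn ℝ k H (Icc 0 1)) : ContDiffOn ℝ k (avgOne a H) (Icc 0 1) :=
  contDiffOn_comp_one_sub (contDiffOn_avg k ha one_pos (contDiffOn_comp_one_sub hH
    fun x hx => ⟨by linarith [hx.2], by linarith [hx.1]⟩))
    fun x hx => ⟨by linarith [hx.2], by linarith [hx.1]⟩

theorem contDiffOn_avgOne_succ (k : ℕ) {a : ℝ} (ha : 0 ≤ a) {H : ℝ → ℂ}
    (hH : ContDiffOn ℝ k H (Icc 0 1)) : ContDiffOn ℝ (k + 1 : ℕ) (avgOne a H) (Ico 0 1) :=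
  contDiffOn_comp_one_sub (contDiffOn_avg_succ k ha one_pos (contDiffOn_comp_one_sub hH
    fun x hx => ⟨by linarith [hx.2], by linarith [hx.1]⟩))
    fun x hx => ⟨by linarith [hx.2], by linarith [hx.1]⟩

/-- With `u = x v`, the solution of `-w⁻¹ (p f')' = u`, `f(0) = 0`, that is smooth at `1` is
`f = x (divGreen a v)`, where `a = 1 / ε`. -/
def divGreen (a : ℝ) (v : ℝ → ℂ) : ℝ → ℂ :=
  avg 0 fun t => (1 + t) ^ (a - 1) • avgOne a (fun y => (1 + y) ^ (-a) • v y) t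

theorem contDiffOn_one_add_rpow (n : WithTop ℕ∞) (c : ℝ) :
    ContDiffOn ℝ n (fun t : ℝ => (1 + t) ^ c) (Icc 0 1) :=
  (contDiff_const.add contDiff_id).contDiffOn.rpow_const_of_ne fun x hx =>
    (by have := hx.1; simp only [id]; linarith : (0 : ℝ) < 1 + id x).ne'

theorem contDiffOn_divGreen (k : ℕ) {a : ℝ} (ha : 0 ≤ a) {v : ℝ → ℂ}
    (hv : ContDiffOn ℝ k v (Icc 0 1)) : ContDiffOn ℝ k (divGreen a v) (Icc 0 1) :=
  contDiffOn_avg k le_rfl one_pos ((contDiffOn_one_add_rpow _ _).smul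
    (contDiffOn_avgOne k ha ((contDiffOn_one_add_rpow _ _).smul hv)))

/-- On `[0, 1/2]` the inner average, based at `1`, gains the derivative and the outer one preserves
it. On `(0, 1]` the inner average preserves `C^k` and the outer one, based at `0`, gains. -/
theorem contDiffOn_divGreen_succ (k : ℕ) {a : ℝ} (ha : 0 ≤ a) {v : ℝ → ℂ}
    (hv : ContDiffOn ℝ k v (Icc 0 1)) : ContDiffOn ℝ (k + 1 : ℕ) (divGreen a v) (Icc 0 1) := by
  have hv' := (contDiffOn_one_add_rpow k (-a)).smul hv
  have h0 : ContDiffOn ℝ (k + 1 : ℕ) (divGreen a v) (Icc 0 (1 / 2)) :=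
    contDiffOn_avg (k + 1) le_rfl (by norm_num)
      (((contDiffOn_one_add_rpow _ _).mono (Icc_subset_Icc_right (by norm_num))).smul
        ((contDiffOn_avgOne_succ k ha hv').mono fun x hx => ⟨hx.1, by linarith [hx.2]⟩))
  have h1 : ContDiffOn ℝ (k + 1 : ℕ) (divGreen a v) (Ioc 0 1) :=
    contDiffOn_avg_succ k le_rfl one_pos ((contDiffOn_one_add_rpow _ _).smul
      (contDiffOn_avgOne k ha hv'))
  intro x hx
  rcases lt_or_ge x (1 / 2) with h | h
  · refine (h0 x ⟨hx.1, h.le⟩).mono_of_mem_nhdsWithin ?_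
    filter_upwards [self_mem_nhdsWithin, mem_nhdsWithin_of_mem_nhds (gt_mem_nhds h)] with y hy hy'
    exact ⟨hy.1, hy'.le⟩
  · have h' : 0 < x := by linarith
    refine (h1 x ⟨h', hx.2⟩).mono_of_mem_nhdsWithin ?_
    filter_upwards [self_mem_nhdsWithin, mem_nhdsWithin_of_mem_nhds (lt_mem_nhds h')] with y hy hy'
    exact ⟨hy', hy.2⟩

theorem contDiffOn_of_eqOn_divGreen {a : ℝ} (ha : 0 ≤ a) {v : ℝ → ℂ} {μ : ℂ}
    (hv : ContinuousOn v (Icc 0 1)) (he : EqOn v (fun x => μ * divGreen a v x) (Icc 0 1)) :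
    ContDiffOn ℝ ∞ v (Icc 0 1) := by
  refine contDiffOn_infty.2 fun k => ?_
  induction k with
  | zero => exact contDiffOn_zero.2 hv
  | succ k ih => exact (contDiffOn_const.mul (contDiffOn_divGreen_succ k ha ih)).congr he

/-! ### Integration against the weight, and the primitive of `1 / p` -/

theorem integrable_weightMeasure_iff {ε : ℝ} {E : Type*} [NormedAddCommGroup E] [NormedSpace ℝ E]
    {g : ℝ → E} : Integrable g (weightMeasure ε) ↔
      IntegrableOn (fun x => w ε x • g x) (Ioo 0 1) := by
  rw [weightMeasure, integrable_withDensity_iff_integrable_smul' (measurable_w ε).ennreal_ofReal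
    (by simp)]
  refine integrable_congr (ae_restrict_of_forall_mem measurableSet_Ioo fun x hx => ?_)
  simp only [ENNReal.toReal_ofReal (w_pos hx).le]

theorem integral_weightMeasure (ε : ℝ) {E : Type*} [NormedAddCommGroup E] [NormedSpace ℝ E]
    (g : ℝ → E) : ∫ x, g x ∂(weightMeasure ε) = ∫ x in Ioo 0 1, w ε x • g x := by
  rw [weightMeasure, integral_withDensity_eq_integral_toReal_smul (measurable_w ε).ennreal_ofReal
    (by simp)]
  refine integral_congr_ae (ae_restrict_of_forall_mem measurableSet_Ioo fun x hx => ?_)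
  simp only [ENNReal.toReal_ofReal (w_pos hx).le]

/-- The primitive of `1 / p` that vanishes at `0`. -/
def pInt (ε x : ℝ) : ℝ := (((1 + x) / (1 - x)) ^ (1 / ε) - 1) / (2 * (1 / ε))

theorem p_pos {ε x : ℝ} (hx : x ∈ Ico (0 : ℝ) 1) : 0 < p ε x := by
  have h1 : 0 < 1 - x := by linarith [hx.2]
  have h2 : 0 < 1 + x := by linarith [hx.1]
  unfold p
  positivity

theorem p_one {ε : ℝ} (hε : 0 < ε) : p ε 1 = 0 := by
  have : 1 + 1 / ε ≠ 0 := by positivity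
  rw [p, sub_self, Real.zero_rpow this, zero_mul]

theorem continuousOn_p {ε : ℝ} (hε : 0 < ε) : ContinuousOn (p ε) (Icc 0 1) := by
  have h : 0 ≤ 1 + 1 / ε := by positivity
  refine ContinuousOn.mul ?_ ?_
  · exact ((continuous_const.sub continuous_id).rpow_const fun _ => Or.inr h).continuousOn
  · exact (continuous_const.add continuous_id).continuousOn.rpow_const
      fun x hx => Or.inl (by have := hx.1; simp only [id]; linarith : (0 : ℝ) < 1 + id x).ne'

theorem differentiableAt_p {ε x : ℝ} (hx : x ∈ Ico (0 : ℝ) 1) : DifferentiableAt ℝ (p ε) x := by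
  have h1 : 0 < 1 - x := by linarith [hx.2]
  have h2 : 0 < 1 + x := by linarith [hx.1]
  exact (((hasDerivAt_id x).const_sub 1).rpow_const
      (p := 1 + 1 / ε) (Or.inl h1.ne')).differentiableAt.mul
    (((hasDerivAt_id x).const_add 1).rpow_const (p := 1 - 1 / ε) (Or.inl h2.ne')).differentiableAt

theorem pInt_zero (ε : ℝ) : pInt ε 0 = 0 := by simp [pInt]

theorem hasDerivAt_pInt {ε : ℝ} (hε : 0 < ε) {x : ℝ} (hx : x ∈ Ico (0 : ℝ) 1) :
    HasDerivAt (pInt ε) (p ε x)⁻¹ x := by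
  have h1 : 0 < 1 - x := by linarith [hx.2]
  have h2 : 0 < 1 + x := by linarith [hx.1]
  have ha : 0 < 1 / ε := by positivity
  have hd := (((hasDerivAt_id x).const_add 1).div ((hasDerivAt_id x).const_sub 1) h1.ne')
  have hr := ((hd.rpow_const (p := 1 / ε) (Or.inl (div_pos h2 h1).ne')).sub_const 1).div_const
    (2 * (1 / ε))
  refine hr.congr_deriv ?_
  simp only [id, Pi.div_apply, p]
  generalize 1 / ε = a at *
  rw [Real.div_rpow h2.le h1.le, Real.rpow_sub h2, Real.rpow_add h1, Real.rpow_sub h1,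
    Real.rpow_sub h2, Real.rpow_one, Real.rpow_one]
  have e1 := (Real.rpow_pos_of_pos h1 a).ne'
  have e2 := (Real.rpow_pos_of_pos h2 a).ne'
  field_simp
  ring

theorem continuousOn_pInt {ε : ℝ} (hε : 0 < ε) : ContinuousOn (pInt ε) (Ico 0 1) :=
  fun _ hx => (hasDerivAt_pInt hε hx).continuousAt.continuousWithinAt

theorem strictMonoOn_pInt {ε : ℝ} (hε : 0 < ε) : StrictMonoOn (pInt ε) (Ico 0 1) := by
  refine strictMonoOn_of_deriv_pos (convex_Ico 0 1) (continuousOn_pInt hε) fun x hx => ?_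
  rw [interior_Ico] at hx
  rw [(hasDerivAt_pInt hε (Ioo_subset_Ico_self hx)).deriv]
  exact inv_pos.2 (p_pos (Ioo_subset_Ico_self hx))

theorem pInt_nonneg {ε : ℝ} (hε : 0 < ε) {x : ℝ} (hx : x ∈ Ico (0 : ℝ) 1) : 0 ≤ pInt ε x := by
  rw [← pInt_zero ε]
  exact (strictMonoOn_pInt hε).monotoneOn (left_mem_Ico.2 one_pos) hx hx.1

theorem pInt_pos {ε : ℝ} (hε : 0 < ε) {x : ℝ} (hx : x ∈ Ioo (0 : ℝ) 1) : 0 < pInt ε x := by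
  rw [← pInt_zero ε]
  exact strictMonoOn_pInt hε (left_mem_Ico.2 one_pos) (Ioo_subset_Ico_self hx) hx.1

/-- With `a = 1 / ε` and `r = (1 - x) / (1 + x)` the product is `(1 - r ^ a) / (2 a x)`. The powers
singular at `1` cancel, and `1 - r ^ a ≤ max 1 a * (1 - r) ≤ max 1 a * 2 x` absorbs the pole at `0`.
This bound drives both the Poincaré inequality and the kernel estimates. -/
theorem exists_w_mul_pInt_le {ε : ℝ} (hε : 0 < ε) :
    ∃ C, 0 < C ∧ ∀ x ∈ Ioo (0 : ℝ) 1, w ε x * pInt ε x ≤ C := by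
  have ha : 0 < 1 / ε := by positivity
  refine ⟨max 1 (1 / ε) / (1 / ε), by positivity, fun x hx => ?_⟩
  have h0 := hx.1
  have h1 : 0 < 1 - x := by linarith [hx.2]
  have h2 : 0 < 1 + x := by linarith [hx.1]
  have e : w ε x * pInt ε x = (1 - ((1 - x) / (1 + x)) ^ (1 / ε)) / (2 * (1 / ε)) / x := by
    rw [w, pInt, Real.div_rpow h2.le h1.le, Real.div_rpow h1.le h2.le, Real.rpow_neg h2.le]
    have e1 := (Real.rpow_pos_of_pos h1 (1 / ε)).ne'
    have e2 := (Real.rpow_pos_of_pos h2 (1 / ε)).ne'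
    generalize (1 - x) ^ (1 / ε) = A at *
    generalize (1 + x) ^ (1 / ε) = B at *
    field_simp
  rw [e, div_div, div_le_div_iff₀ (by positivity) ha]
  generalize 1 / ε = a at *
  set r := (1 - x) / (1 + x) with hr
  have hr0 : 0 < r := div_pos h1 h2
  have hr1 : r ≤ 1 := by rw [hr, div_le_one h2]; linarith
  have hrx : 1 - r ≤ 2 * x := by
    have : 1 - r = 2 * x / (1 + x) := by rw [hr]; field_simp; ring
    rw [this, div_le_iff₀ h2]
    nlinarith
  have key : 1 - r ^ a ≤ max 1 a * (1 - r) := by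
    rcases le_total a 1 with h | h
    · have h3 : r ^ (1 : ℝ) ≤ r ^ a := Real.rpow_le_rpow_of_exponent_ge hr0 hr1 h
      rw [Real.rpow_one] at h3
      rw [max_eq_left h]
      linarith
    -- Bernoulli's inequality for `r = 1 + (r - 1)`.
    · have h3 := one_add_mul_self_le_rpow_one_add (s := r - 1) (by linarith) h
      rw [max_eq_right h]
      simp only [add_sub_cancel] at h3
      linarith
  have hM : 0 < max 1 a := by positivity
  calc (1 - r ^ a) * a ≤ (max 1 a * (2 * x)) * a := by
        gcongr
        exact key.trans (by gcongr)
    _ = max 1 a * (2 * a * x) := by ring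

theorem exists_pInt_le {ε : ℝ} (hε : 0 < ε) :
    ∃ C, 0 < C ∧ ∀ x ∈ Ioo (0 : ℝ) 1, pInt ε x ≤ C * (1 - x) ^ (-(1 / ε)) := by
  have ha : 0 < 1 / ε := by positivity
  refine ⟨2 ^ (1 / ε) / (2 * (1 / ε)), by positivity, fun x hx => ?_⟩
  have h0 := hx.1
  have h1 : 0 < 1 - x := by linarith [hx.2]
  have h2 : 0 < 1 + x := by linarith [hx.1]
  rw [pInt, Real.div_rpow h2.le h1.le, Real.rpow_neg h1.le, div_mul_eq_mul_div, ← div_eq_mul_inv]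
  have h3 : (1 + x) ^ (1 / ε) ≤ 2 ^ (1 / ε) :=
    Real.rpow_le_rpow h2.le (by linarith [hx.2]) ha.le
  have h4 := Real.rpow_pos_of_pos h1 (1 / ε)
  gcongr
  have : (1 + x) ^ (1 / ε) / (1 - x) ^ (1 / ε) ≤ 2 ^ (1 / ε) / (1 - x) ^ (1 / ε) := by gcongr
  linarith

/-! ### The Dirichlet form and the Poincaré inequality -/

/-- The derivative of a smooth function, continuous up to the end-points. -/
theorem continuousOn_derivWithin {f : ℝ → ℂ} (hf : f ∈ smoothZero) :
    ContinuousOn (derivWithin f (Icc 0 1)) (Icc 0 1) :=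
  (hf.1.derivWithin (m := ∞) (uniqueDiffOn_Icc one_pos) (by simp)).continuousOn

/-- The fundamental theorem of calculus needs the flux `p f'` continuous on the closed interval.
`deriv f` at an end-point depends on the uncontrolled values outside `[0, 1]`, so `derivWithin` is
used instead. -/
theorem continuousOn_flux {ε : ℝ} (hε : 0 < ε) {f : ℝ → ℂ} (hf : f ∈ smoothZero) :
    ContinuousOn (fun x => (p ε x : ℂ) * derivWithin f (Icc 0 1) x) (Icc 0 1) :=
  (Complex.continuous_ofReal.comp_continuousOn (continuousOn_p hε)).mul (continuousOn_derivWithin hf)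

theorem hasDerivAt_flux {ε : ℝ} {f : ℝ → ℂ} (hf : f ∈ smoothZero) {x : ℝ}
    (hx : x ∈ Ioo (0 : ℝ) 1) :
    HasDerivAt (fun x => (p ε x : ℂ) * derivWithin f (Icc 0 1) x) (-(w ε x • slExpr ε f x)) x := by
  have hd : DifferentiableAt ℝ (fun t => (p ε t : ℂ) * deriv f t) x :=
    ((differentiableAt_p (Ioo_subset_Ico_self hx)).hasDerivAt.ofReal_comp.differentiableAt).mul
      (differentiableAt_deriv_of_mem hf hx)
  have e : (fun x => (p ε x : ℂ) * derivWithin f (Icc 0 1) x) =ᶠ[nhds x]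
      fun t => (p ε t : ℂ) * deriv f t :=
    Filter.eventually_of_mem (isOpen_Ioo.mem_nhds hx) fun y hy => by
      simp only [derivWithin_eqOn f hy]
  refine (hd.hasDerivAt.congr_of_eventuallyEq e).congr_deriv ?_
  have hw : (w ε x : ℂ) ≠ 0 := Complex.ofReal_ne_zero.2 (w_pos hx).ne'
  rw [slExpr, Complex.real_smul, mul_neg, neg_neg, mul_inv_cancel_left₀ hw]

/-- The Dirichlet integral `∫₀¹ p |f'|² dx`. -/
def energy (ε : ℝ) (f : ℝ → ℂ) : ℝ := ∫ x in (0 : ℝ)..1, p ε x * ‖deriv f x‖ ^ 2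

theorem continuousOn_energy_density {ε : ℝ} (hε : 0 < ε) {f : ℝ → ℂ} (hf : f ∈ smoothZero) :
    ContinuousOn (fun x => p ε x * ‖derivWithin f (Icc 0 1) x‖ ^ 2) (Icc 0 1) :=
  (continuousOn_p hε).mul ((continuousOn_derivWithin hf).norm.pow 2)

theorem energy_eq (ε : ℝ) (f : ℝ → ℂ) :
    energy ε f = ∫ x in (0 : ℝ)..1, p ε x * ‖derivWithin f (Icc 0 1) x‖ ^ 2 := by
  rw [energy, intervalIntegral.integral_of_le zero_le_one,
    intervalIntegral.integral_of_le zero_le_one, integral_Ioc_eq_integral_Ioo,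
    integral_Ioc_eq_integral_Ioo]
  exact setIntegral_congr_fun measurableSet_Ioo fun x hx => by simp only [derivWithin_eqOn f hx]

/-- Integration by parts: the function `conj (p f') * f` has derivative `p |f'|² - w ⟨L f, f⟩` and
vanishes at both end-points, by `f 0 = 0` and `p ε 1 = 0`. -/
theorem inner_slL2_toL2 {ε : ℝ} (hε : 0 < ε) (f : smoothZero) :
    inner ℂ (slL2 hε f) (toL2 hε f) = (energy ε f : ℂ) := by
  have hf := f.2
  have e1 : inner ℂ (slL2 hε f) (toL2 hε f) =
      ∫ x, inner ℂ (slExpr ε f x) ((f : ℝ → ℂ) x) ∂(weightMeasure ε) := by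
    rw [L2.inner_def]
    refine integral_congr_ae ?_
    filter_upwards [(memLp_slExpr hε f.2).coeFn_toLp, (memLp_self hε f.2).coeFn_toLp] with x h1 h2
    simp only [slL2, toL2, LinearMap.coe_mk, AddHom.coe_mk, h1, h2]
  have hint : Integrable (fun x => inner ℂ (slExpr ε f x) ((f : ℝ → ℂ) x)) (weightMeasure ε) := by
    refine (L2.integrable_inner (𝕜 := ℂ) (slL2 hε f) (toL2 hε f)).congr ?_
    filter_upwards [(memLp_slExpr hε f.2).coeFn_toLp, (memLp_self hε f.2).coeFn_toLp] with x h1 h2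
    simp only [slL2, toL2, LinearMap.coe_mk, AddHom.coe_mk, h1, h2]
  rw [integrable_weightMeasure_iff, ← integrableOn_Ioc_iff_integrableOn_Ioo,
    ← intervalIntegrable_iff_integrableOn_Ioc_of_le zero_le_one] at hint
  rw [e1, integral_weightMeasure, ← integral_Ioc_eq_integral_Ioo,
    ← intervalIntegral.integral_of_le zero_le_one, energy_eq, ← intervalIntegral.integral_ofReal]
  have hE : IntervalIntegrable (fun x => ((p ε x * ‖derivWithin (f : ℝ → ℂ) (Icc 0 1) x‖ ^ 2 : ℝ) : ℂ))
      volume 0 1 := by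
    refine ContinuousOn.intervalIntegrable ?_
    rw [uIcc_of_le zero_le_one]
    exact Complex.continuous_ofReal.comp_continuousOn (continuousOn_energy_density hε hf)
  have key := intervalIntegral.integral_eq_sub_of_hasDerivAt_of_le zero_le_one
    (f := fun x => (starRingEnd ℂ) ((p ε x : ℂ) * derivWithin (f : ℝ → ℂ) (Icc 0 1) x) * (f : ℝ → ℂ) x)
    (f' := fun x => ((p ε x * ‖derivWithin (f : ℝ → ℂ) (Icc 0 1) x‖ ^ 2 : ℝ) : ℂ) -
      w ε x • inner ℂ (slExpr ε f x) ((f : ℝ → ℂ) x))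
    ((Complex.continuous_conj.comp_continuousOn (continuousOn_flux hε hf)).mul hf.1.continuousOn)
    (fun x hx => ?_) (hE.sub hint)
  · rw [intervalIntegral.integral_sub hE hint] at key
    simp only [p_one hε, hf.2, Complex.ofReal_zero, zero_mul, map_zero, mul_zero, sub_zero] at key
    exact (sub_eq_zero.1 key).symm
  · have h0 : HasDerivAt (fun x => (starRingEnd ℂ) ((p ε x : ℂ) * derivWithin (f : ℝ → ℂ) (Icc 0 1) x))
        ((starRingEnd ℂ) (-(w ε x • slExpr ε f x))) x := (hasDerivAt_flux hf hx).star
    have h1 := h0.mul (differentiableAt_of_mem hf hx).hasDerivAt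
    refine h1.congr_deriv ?_
    rw [derivWithin_eqOn _ hx]
    simp only [RCLike.inner_apply, Complex.real_smul, map_neg, map_mul,
      Complex.conj_ofReal, Complex.ofReal_mul, Complex.ofReal_pow, ← Complex.conj_mul']
    ring

theorem integral_inv_p {ε : ℝ} (hε : 0 < ε) {x : ℝ} (hx : x ∈ Ioo (0 : ℝ) 1) :
    ∫ t in (0 : ℝ)..x, (p ε t)⁻¹ = pInt ε x := by
  have hs : Icc 0 x ⊆ Ico (0 : ℝ) 1 := fun t ht => ⟨ht.1, ht.2.trans_lt hx.2⟩
  rw [intervalIntegral.integral_eq_sub_of_hasDerivAt (f := pInt ε), pInt_zero, sub_zero]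
  · intro t ht
    rw [uIcc_of_le hx.1.le] at ht
    exact hasDerivAt_pInt hε (hs ht)
  · refine ContinuousOn.intervalIntegrable ?_
    rw [uIcc_of_le hx.1.le]
    exact ((continuousOn_p hε).mono (hs.trans Ico_subset_Icc_self)).inv₀
      fun t ht => (p_pos (hs ht)).ne'

/-- Cauchy-Schwarz for `|f x| ≤ ∫₀ˣ p ^ (-1/2) * (p ^ (1/2) |f'|)`. -/
theorem norm_sq_le_pInt_mul_energy {ε : ℝ} (hε : 0 < ε) {f : ℝ → ℂ} (hf : f ∈ smoothZero) {x : ℝ}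
    (hx : x ∈ Ioo (0 : ℝ) 1) : ‖f x‖ ^ 2 ≤ pInt ε x * energy ε f := by
  set d := derivWithin f (Icc 0 1) with hd
  have hs : Icc 0 x ⊆ Ico (0 : ℝ) 1 := fun t ht => ⟨ht.1, ht.2.trans_lt hx.2⟩
  have hs' : Icc 0 x ⊆ Icc (0 : ℝ) 1 := hs.trans Ico_subset_Icc_self
  have hu : uIcc 0 x = Icc 0 x := uIcc_of_le hx.1.le
  have cd : ContinuousOn d (Icc 0 x) := (continuousOn_derivWithin hf).mono hs'
  have cp : ContinuousOn (fun t => (p ε t)⁻¹) (Icc 0 x) :=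
    ((continuousOn_p hε).mono hs').inv₀ fun t ht => (p_pos (hs ht)).ne'
  have ce := (continuousOn_energy_density hε hf).mono hs'
  have hP := pInt_pos hε hx
  have i1 : IntervalIntegrable (fun t => ‖d t‖) volume 0 x :=
    (hu ▸ cd.norm : ContinuousOn _ (uIcc 0 x)).intervalIntegrable
  have i2 : IntervalIntegrable (fun t => (p ε t)⁻¹) volume 0 x :=
    (hu ▸ cp : ContinuousOn _ (uIcc 0 x)).intervalIntegrable
  have i3 : IntervalIntegrable (fun t => p ε t * ‖d t‖ ^ 2) volume 0 x :=
    (hu ▸ ce : ContinuousOn _ (uIcc 0 x)).intervalIntegrable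
  have hfx : f x = ∫ t in (0 : ℝ)..x, d t := by
    rw [intervalIntegral.integral_eq_sub_of_hasDerivAt_of_le hx.1.le
      (hf.1.continuousOn.mono hs') (fun t ht => ?_)
      (hu ▸ cd : ContinuousOn _ (uIcc 0 x)).intervalIntegrable, hf.2, sub_zero]
    have ht' : t ∈ Ioo (0 : ℝ) 1 := ⟨ht.1, ht.2.trans hx.2⟩
    rw [hd, derivWithin_eqOn f ht']
    exact (differentiableAt_of_mem hf ht').hasDerivAt
  set N := ∫ t in (0 : ℝ)..x, ‖d t‖
  have hN : ‖f x‖ ≤ N := by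
    rw [hfx]
    exact intervalIntegral.norm_integral_le_integral_norm hx.1.le
  have hE : ∫ t in (0 : ℝ)..x, p ε t * ‖d t‖ ^ 2 ≤ energy ε f := by
    rw [energy_eq]
    refine intervalIntegral.integral_mono_interval le_rfl hx.1.le hx.2.le ?_ ?_
    · refine ae_restrict_of_forall_mem measurableSet_Ioc fun t ht => ?_
      rcases ht.2.eq_or_lt with rfl | h
      · simp [p_one hε]
      · have := p_pos (ε := ε) (x := t) ⟨ht.1.le, h⟩
        simp only [Pi.zero_apply]
        positivity
    · refine ContinuousOn.intervalIntegrable ?_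
      rw [uIcc_of_le zero_le_one]
      exact continuousOn_energy_density hε hf
  -- Cauchy-Schwarz by completing the square: the integrand is `p (|f'| - c / p)²`, with `c = N /
  -- P(x)` the optimal constant.
  have hsq : 0 ≤ ∫ t in (0 : ℝ)..x,
      (p ε t * ‖d t‖ ^ 2 - 2 * (N / pInt ε x) * ‖d t‖ + (N / pInt ε x) ^ 2 * (p ε t)⁻¹) := by
    refine intervalIntegral.integral_nonneg hx.1.le fun t ht => ?_
    have hp := p_pos (ε := ε) (hs ht)
    have : p ε t * ‖d t‖ ^ 2 - 2 * (N / pInt ε x) * ‖d t‖ + (N / pInt ε x) ^ 2 * (p ε t)⁻¹ =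
        p ε t * (‖d t‖ - N / pInt ε x * (p ε t)⁻¹) ^ 2 := by
      field_simp
      ring
    rw [this]
    positivity
  rw [intervalIntegral.integral_add (i3.sub (i1.const_mul _)) (i2.const_mul _),
    intervalIntegral.integral_sub i3 (i1.const_mul _), intervalIntegral.integral_const_mul,
    intervalIntegral.integral_const_mul, integral_inv_p hε hx] at hsq
  have hkey : N ^ 2 ≤ pInt ε x * ∫ t in (0 : ℝ)..x, p ε t * ‖d t‖ ^ 2 := by
    have e : 2 * (N / pInt ε x) * N = 2 * (N ^ 2 / pInt ε x) := by ring
    have e' : (N / pInt ε x) ^ 2 * pInt ε x = N ^ 2 / pInt ε x := by field_simp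
    rw [show (∫ t in (0 : ℝ)..x, ‖d t‖) = N from rfl, e, e'] at hsq
    have : N ^ 2 / pInt ε x ≤ ∫ t in (0 : ℝ)..x, p ε t * ‖d t‖ ^ 2 := by linarith
    rwa [div_le_iff₀' hP] at this
  calc ‖f x‖ ^ 2 ≤ N ^ 2 := by gcongr
    _ ≤ _ := hkey
    _ ≤ _ := by gcongr

/-- The Poincaré inequality for `L`. -/
theorem exists_norm_toL2_sq_le {ε : ℝ} (hε : 0 < ε) :
    ∃ C, 0 < C ∧ ∀ f : smoothZero, ‖toL2 hε f‖ ^ 2 ≤ C * energy ε f := by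
  obtain ⟨C, hC, hw⟩ := exists_w_mul_pInt_le hε
  refine ⟨C, hC, fun f => ?_⟩
  have hE : 0 ≤ energy ε f := by
    have h2 : (1 / 2 : ℝ) ∈ Ioo (0 : ℝ) 1 := by norm_num
    have := (sq_nonneg _).trans (norm_sq_le_pInt_mul_energy hε f.2 h2)
    exact nonneg_of_mul_nonneg_right this (pInt_pos hε h2)
  have h1 : ‖toL2 hε f‖ ^ 2 = ∫ x in Ioo (0 : ℝ) 1, w ε x • ‖(f : ℝ → ℂ) x‖ ^ 2 := by
    rw [← integral_weightMeasure, ← RCLike.ofReal_inj (K := ℂ), RCLike.ofReal_pow,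
      ← inner_self_eq_norm_sq_to_K, L2.inner_def, ← integral_ofReal]
    refine integral_congr_ae ?_
    filter_upwards [(memLp_self hε f.2).coeFn_toLp] with x hx
    simp only [toL2, LinearMap.coe_mk, AddHom.coe_mk, hx]
    rw [inner_self_eq_norm_sq_to_K, RCLike.ofReal_pow]
  rw [h1]
  have h2 : ∫ x in Ioo (0 : ℝ) 1, w ε x • ‖(f : ℝ → ℂ) x‖ ^ 2 ≤
      ∫ x in Ioo (0 : ℝ) 1, C * energy ε f := by
    refine integral_mono_of_nonneg ?_ (integrableOn_const (by simp)) ?_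
    · refine ae_restrict_of_forall_mem measurableSet_Ioo fun x hx => ?_
      have := w_pos (ε := ε) hx
      simp only [Pi.zero_apply]
      positivity
    · refine ae_restrict_of_forall_mem measurableSet_Ioo fun x hx => ?_
      have := w_pos (ε := ε) hx
      calc w ε x * ‖(f : ℝ → ℂ) x‖ ^ 2 ≤ w ε x * (pInt ε x * energy ε f) := by
            gcongr
            exact norm_sq_le_pInt_mul_energy hε f.2 hx
        _ = w ε x * pInt ε x * energy ε f := by ring
        _ ≤ C * energy ε f := by
            gcongr
            exact hw x hx
  simpa using h2

/-! ### The Green kernel and its reproducing property -/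

/-- The Green kernel `P(min(x, y))`, with `P` the primitive of `1 / p` that vanishes at `0`. -/
def kern (ε x y : ℝ) : ℂ := (pInt ε (min x y) : ℂ)

theorem continuousOn_kern {ε : ℝ} (hε : 0 < ε) {x : ℝ} (hx : x ∈ Ioo (0 : ℝ) 1) :
    ContinuousOn (kern ε x) (Ioo 0 1) :=
  Complex.continuous_ofReal.comp_continuousOn ((continuousOn_pInt hε).comp
    (continuous_const.min continuous_id).continuousOn
    fun _ hy => ⟨le_min hx.1.le hy.1.le, (min_le_left _ _).trans_lt hx.2⟩)

theorem norm_kern {ε : ℝ} (hε : 0 < ε) {x y : ℝ} (hx : x ∈ Ioo (0 : ℝ) 1)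
    (hy : y ∈ Ioo (0 : ℝ) 1) : ‖kern ε x y‖ = pInt ε (min x y) := by
  rw [kern, Complex.norm_real, Real.norm_of_nonneg (pInt_nonneg hε
    ⟨le_min hx.1.le hy.1.le, (min_le_left _ _).trans_lt hx.2⟩)]

theorem pInt_min_le_left {ε : ℝ} (hε : 0 < ε) {x y : ℝ} (hx : x ∈ Ioo (0 : ℝ) 1)
    (hy : y ∈ Ioo (0 : ℝ) 1) : pInt ε (min x y) ≤ pInt ε x :=
  (strictMonoOn_pInt hε).monotoneOn ⟨le_min hx.1.le hy.1.le, (min_le_left _ _).trans_lt hx.2⟩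
    (Ioo_subset_Ico_self hx) (min_le_left _ _)

theorem pInt_min_le_right {ε : ℝ} (hε : 0 < ε) {x y : ℝ} (hx : x ∈ Ioo (0 : ℝ) 1)
    (hy : y ∈ Ioo (0 : ℝ) 1) : pInt ε (min x y) ≤ pInt ε y := by
  rw [min_comm]
  exact pInt_min_le_left hε hy hx

/-- `P` is increasing, so `P(min(x, y))² ≤ P(x) P(y)`, and `w(y) P(y) ≤ C`. -/
theorem w_mul_norm_kern_sq_le {ε : ℝ} (hε : 0 < ε) {C : ℝ}
    (hC : ∀ x ∈ Ioo (0 : ℝ) 1, w ε x * pInt ε x ≤ C) {x y : ℝ} (hx : x ∈ Ioo (0 : ℝ) 1)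
    (hy : y ∈ Ioo (0 : ℝ) 1) : w ε y * ‖kern ε x y‖ ^ 2 ≤ C * pInt ε x := by
  rw [norm_kern hε hx hy, sq]
  have h0 := pInt_nonneg hε (x := min x y)
    ⟨le_min hx.1.le hy.1.le, (min_le_left _ _).trans_lt hx.2⟩
  have hw := w_pos (ε := ε) hy
  have hx0 := pInt_pos hε hx
  calc w ε y * (pInt ε (min x y) * pInt ε (min x y)) ≤ w ε y * (pInt ε y * pInt ε x) := by
        gcongr
        exacts [pInt_nonneg hε (Ioo_subset_Ico_self hy), pInt_min_le_right hε hx hy,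
          pInt_min_le_left hε hx hy]
    _ = w ε y * pInt ε y * pInt ε x := by ring
    _ ≤ C * pInt ε x := by
        gcongr
        exact hC y hy

theorem memLp_kern {ε : ℝ} (hε : 0 < ε) {x : ℝ} (hx : x ∈ Ioo (0 : ℝ) 1) :
    MemLp (kern ε x) 2 (weightMeasure ε) := by
  obtain ⟨C, -, hC⟩ := exists_w_mul_pInt_le hε
  have hm : AEStronglyMeasurable (kern ε x) (volume.restrict (Ioo (0 : ℝ) 1)) :=
    (continuousOn_kern hε hx).aestronglyMeasurable measurableSet_Ioo
  have hm' : AEStronglyMeasurable (kern ε x) (weightMeasure ε) :=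
    hm.mono_ac (withDensity_absolutelyContinuous _ _)
  rw [memLp_two_iff_integrable_sq_norm hm', integrable_weightMeasure_iff]
  refine Integrable.mono' (g := fun _ => C * pInt ε x) (integrableOn_const (by simp))
    ((measurable_w ε).aestronglyMeasurable.smul (hm.norm.pow 2))
    (ae_restrict_of_forall_mem measurableSet_Ioo fun y hy => ?_)
  have hw := w_pos (ε := ε) hy
  rw [smul_eq_mul, Real.norm_of_nonneg (by positivity)]
  exact w_mul_norm_kern_sq_le hε hC hx hy

/-- The class of the Green kernel in `L²((0, 1), w(x) dx)`. -/
def kernL2 {ε : ℝ} (hε : 0 < ε) {x : ℝ} (hx : x ∈ Ioo (0 : ℝ) 1) : WeightedL2 ε :=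
  (memLp_kern hε hx).toLp (kern ε x)

theorem integrableOn_kern_mul {ε : ℝ} (hε : 0 < ε) {x : ℝ} (hx : x ∈ Ioo (0 : ℝ) 1)
    (u : WeightedL2 ε) : IntegrableOn (fun y => w ε y • (kern ε x y * u y)) (Ioo 0 1) := by
  rw [← integrable_weightMeasure_iff]
  exact MemLp.integrable_mul (memLp_kern hε hx) (Lp.memLp u)

theorem inner_kernL2 {ε : ℝ} (hε : 0 < ε) {x : ℝ} (hx : x ∈ Ioo (0 : ℝ) 1) (u : WeightedL2 ε) :
    inner ℂ (kernL2 hε hx) u = ∫ y in Ioo 0 1, w ε y • (kern ε x y * u y) := by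
  rw [← integral_weightMeasure, L2.inner_def]
  refine integral_congr_ae ?_
  filter_upwards [(memLp_kern hε hx).coeFn_toLp] with y h
  rw [kernL2, h, RCLike.inner_apply, kern, Complex.conj_ofReal, mul_comm]

/-- The source of the initial growth bound `P ^ (1/2)` for eigenvectors, through `|⟨k_x, u⟩| ≤ ‖k_x‖
‖u‖`. -/
theorem exists_norm_kernL2_sq_le {ε : ℝ} (hε : 0 < ε) :
    ∃ C, 0 < C ∧ ∀ x, ∀ hx : x ∈ Ioo (0 : ℝ) 1, ‖kernL2 hε hx‖ ^ 2 ≤ C * pInt ε x := by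
  obtain ⟨C, hC0, hC⟩ := exists_w_mul_pInt_le hε
  refine ⟨C, hC0, fun x hx => ?_⟩
  have h1 : ‖kernL2 hε hx‖ ^ 2 = ∫ y in Ioo (0 : ℝ) 1, w ε y • ‖kern ε x y‖ ^ 2 := by
    rw [← integral_weightMeasure, ← RCLike.ofReal_inj (K := ℂ), RCLike.ofReal_pow,
      ← inner_self_eq_norm_sq_to_K, L2.inner_def, ← integral_ofReal]
    refine integral_congr_ae ?_
    filter_upwards [(memLp_kern hε hx).coeFn_toLp] with y hy
    rw [kernL2, hy, inner_self_eq_norm_sq_to_K, RCLike.ofReal_pow]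
  rw [h1]
  have h2 : ∫ y in Ioo (0 : ℝ) 1, w ε y • ‖kern ε x y‖ ^ 2 ≤
      ∫ y in Ioo (0 : ℝ) 1, C * pInt ε x := by
    refine integral_mono_of_nonneg ?_ (integrableOn_const (by simp)) ?_
    · refine ae_restrict_of_forall_mem measurableSet_Ioo fun y hy => ?_
      have := w_pos (ε := ε) hy
      simp only [Pi.zero_apply]
      positivity
    · exact ae_restrict_of_forall_mem measurableSet_Ioo fun y hy =>
        w_mul_norm_kern_sq_le hε hC hx hy
  simpa using h2

theorem integral_Ioo_split {E : Type*} [NormedAddCommGroup E] [NormedSpace ℝ E] {g : ℝ → E}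
    (hg : IntegrableOn g (Ioo 0 1)) {x : ℝ} (hx : x ∈ Ioo (0 : ℝ) 1) :
    IntervalIntegrable g volume 0 x ∧ IntervalIntegrable g volume x 1 ∧
      ∫ y in Ioo 0 1, g y = (∫ y in (0 : ℝ)..x, g y) + ∫ y in x..1, g y := by
  rw [← integrableOn_Ioc_iff_integrableOn_Ioo,
    ← intervalIntegrable_iff_integrableOn_Ioc_of_le zero_le_one] at hg
  have h1 : IntervalIntegrable g volume 0 x := hg.mono_set (by
    rw [uIcc_of_le hx.1.le, uIcc_of_le zero_le_one]
    exact Icc_subset_Icc_right hx.2.le)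
  have h2 : IntervalIntegrable g volume x 1 := hg.mono_set (by
    rw [uIcc_of_le hx.2.le, uIcc_of_le zero_le_one]
    exact Icc_subset_Icc_left hx.1.le)
  refine ⟨h1, h2, ?_⟩
  rw [intervalIntegral.integral_add_adjacent_intervals h1 h2,
    intervalIntegral.integral_of_le zero_le_one, integral_Ioc_eq_integral_Ioo]

/-- The integrand `w k_x L f` has primitive `f - P p f'` on `(0, x)` and `-P(x) p f'` on `(x, 1)`.
The flux terms at `x` cancel, those at `0` and `1` vanish, and `f x` remains. -/
theorem inner_kernL2_slL2 {ε : ℝ} (hε : 0 < ε) {x : ℝ} (hx : x ∈ Ioo (0 : ℝ) 1) (f : smoothZero) :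
    inner ℂ (kernL2 hε hx) (slL2 hε f) = (f : ℝ → ℂ) x := by
  have hf := f.2
  have hae : ∀ᵐ y ∂(volume.restrict (Ioo (0 : ℝ) 1)),
      w ε y • (kern ε x y * slL2 hε f y) = w ε y • (kern ε x y * slExpr ε f y) := by
    refine ae_volume_of_ae_weightMeasure (ε := ε) ?_
    filter_upwards [(memLp_slExpr hε f.2).coeFn_toLp] with y hy
    simp only [slL2, LinearMap.coe_mk, AddHom.coe_mk, hy]
  have hint := (integrableOn_kern_mul hε hx (slL2 hε f)).congr hae
  obtain ⟨i1, i2, hsplit⟩ := integral_Ioo_split hint hx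
  rw [inner_kernL2, integral_congr_ae hae, hsplit]
  have hsub : Icc 0 x ⊆ Ico (0 : ℝ) 1 := fun t ht => ⟨ht.1, ht.2.trans_lt hx.2⟩
  have hflux := continuousOn_flux hε hf
  have cP : ContinuousOn (fun y => (pInt ε y : ℂ)) (Icc 0 x) :=
    Complex.continuous_ofReal.comp_continuousOn ((continuousOn_pInt hε).mono hsub)
  have k1 := intervalIntegral.integral_eq_sub_of_hasDerivAt_of_le hx.1.le
    (f := fun y => (f : ℝ → ℂ) y -
      (pInt ε y : ℂ) * ((p ε y : ℂ) * derivWithin (f : ℝ → ℂ) (Icc 0 1) y))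
    (f' := fun y => w ε y • (kern ε x y * slExpr ε f y))
    ((hf.1.continuousOn.mono (hsub.trans Ico_subset_Icc_self)).sub
      (cP.mul (hflux.mono (hsub.trans Ico_subset_Icc_self)))) (fun y hy => ?_) i1
  · have k2 := intervalIntegral.integral_eq_sub_of_hasDerivAt_of_le hx.2.le
      (f := fun y => -((pInt ε x : ℂ) * ((p ε y : ℂ) * derivWithin (f : ℝ → ℂ) (Icc 0 1) y)))
      (f' := fun y => w ε y • (kern ε x y * slExpr ε f y))
      ((continuousOn_const.mul (hflux.mono (Icc_subset_Icc_left hx.1.le))).neg) (fun y hy => ?_) i2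
    · rw [k1, k2]
      simp [pInt_zero, p_one hε, hf.2]
    · have hy' : y ∈ Ioo (0 : ℝ) 1 := ⟨hx.1.trans hy.1, hy.2⟩
      refine ((hasDerivAt_flux hf hy').const_mul (pInt ε x : ℂ)).neg.congr_deriv ?_
      rw [kern, min_eq_left hy.1.le, Complex.real_smul, Complex.real_smul]
      ring
  · have hy' : y ∈ Ioo (0 : ℝ) 1 := ⟨hy.1, hy.2.trans hx.2⟩
    have hp : (p ε y : ℂ) ≠ 0 := Complex.ofReal_ne_zero.2 (p_pos (Ioo_subset_Ico_self hy')).ne'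
    refine ((differentiableAt_of_mem hf hy').hasDerivAt.sub
      ((hasDerivAt_pInt hε (Ioo_subset_Ico_self hy')).ofReal_comp.mul
        (hasDerivAt_flux (ε := ε) hf hy'))).congr_deriv ?_
    rw [kern, min_eq_right hy.2.le, Complex.real_smul, Complex.real_smul, Complex.ofReal_inv,
      inv_mul_cancel_left₀ hp, derivWithin_eqOn _ hy']
    ring

/-! ### Explicit solution of `L f = g`, and density of the range -/

theorem hasDerivAt_rpow_mul_avg {b : ℝ} (hb : 0 ≤ b) {H : ℝ → ℂ} (hH : ContinuousOn H (Icc 0 1))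
    {x : ℝ} (hx : x ∈ Ioo (0 : ℝ) 1) :
    HasDerivAt (fun y => (y ^ (b + 1)) • avg b H y) ((x ^ b) • H x) x := by
  obtain ⟨g, hg, he⟩ := exists_contDiff_extension 0 one_pos (contDiffOn_zero.2 hH)
  have hc : Continuous fun t : ℝ => (t ^ b) • g t :=
    (Real.continuous_rpow_const hb).smul hg.continuous
  rw [he (Ioo_subset_Icc_self hx)]
  refine ((hc.integral_hasStrictDerivAt 0 x).hasDerivAt).congr_of_eventuallyEq ?_
  filter_upwards [isOpen_Ioo.mem_nhds hx] with y hy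
  rw [avg_congr he (Ioo_subset_Icc_self hy), rpow_mul_avg g hy.1]

theorem hasDerivAt_mul_avg_zero {H : ℝ → ℂ} (hH : ContinuousOn H (Icc 0 1))
    {x : ℝ} (hx : x ∈ Ioo (0 : ℝ) 1) : HasDerivAt (fun y : ℝ => (y : ℂ) * avg 0 H y) (H x) x := by
  simpa using hasDerivAt_rpow_mul_avg le_rfl hH hx

theorem hasDerivAt_rpow_mul_avgOne {b : ℝ} (hb : 0 ≤ b) {H : ℝ → ℂ}
    (hH : ContinuousOn H (Icc 0 1)) {x : ℝ} (hx : x ∈ Ioo (0 : ℝ) 1) :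
    HasDerivAt (fun y => ((1 - y) ^ (b + 1)) • avgOne b H y) (-(((1 - x) ^ b) • H x)) x := by
  have hx' : 1 - x ∈ Ioo (0 : ℝ) 1 := ⟨by linarith [hx.2], by linarith [hx.1]⟩
  have hH' : ContinuousOn (fun t => H (1 - t)) (Icc 0 1) :=
    hH.comp (continuous_const.sub continuous_id).continuousOn
      fun x hx => ⟨by linarith [hx.2], by linarith [hx.1]⟩
  have h := (hasDerivAt_rpow_mul_avg hb hH' hx').scomp x ((hasDerivAt_id x).const_sub 1)
  simpa [Function.comp_def, avgOne] using! h

theorem p_mul_rpow_smul {ε : ℝ} {x : ℝ} (hx : x ∈ Ioo (0 : ℝ) 1) (z : ℂ) :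
    (p ε x : ℂ) * ((1 + x) ^ (1 / ε - 1) • z) = ((1 - x) ^ (1 / ε + 1)) • z := by
  have h2 : 0 < 1 + x := by linarith [hx.1]
  rw [p, ← Complex.real_smul, smul_smul, mul_assoc, ← Real.rpow_add h2]
  have : 1 - 1 / ε + (1 / ε - 1) = 0 := by ring
  rw [this, Real.rpow_zero, mul_one, add_comm]

theorem w_mul_eq {ε : ℝ} {x : ℝ} (hx : x ∈ Ioo (0 : ℝ) 1) :
    w ε x * x = (1 - x) ^ (1 / ε) * (1 + x) ^ (-(1 / ε)) := by
  have := hx.1.ne'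
  rw [w]
  field_simp

/-- The solution `x (divGreen a v)` of `-w⁻¹ (p f')' = x v`, for smooth `v`. -/
def greenSol {ε : ℝ} (hε : 0 < ε) {v : ℝ → ℂ} (hv : ContDiffOn ℝ ∞ v (Icc 0 1)) : smoothZero :=
  ⟨fun x => (x : ℂ) * divGreen (1 / ε) v x,
    (Complex.ofRealCLM.contDiff.contDiffOn).mul (contDiffOn_infty.2 fun k =>
      contDiffOn_divGreen k (by positivity) (contDiffOn_infty.1 hv k)), by simp⟩

theorem slExpr_greenSol {ε : ℝ} (hε : 0 < ε) {v : ℝ → ℂ} (hv : ContDiffOn ℝ ∞ v (Icc 0 1)) {x : ℝ}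
    (hx : x ∈ Ioo (0 : ℝ) 1) : slExpr ε (greenSol hε hv) x = x * v x := by
  have ha : 0 ≤ 1 / ε := by positivity
  have hK : ContDiffOn ℝ 0 (fun y : ℝ => (1 + y) ^ (-(1 / ε)) • v y) (Icc 0 1) :=
    (contDiffOn_one_add_rpow 0 (-(1 / ε))).smul (contDiffOn_infty.1 hv 0)
  have hA := (contDiffOn_one_add_rpow 0 (1 / ε - 1)).smul (contDiffOn_avgOne 0 ha hK)
  have h1 : ∀ y ∈ Ioo (0 : ℝ) 1, deriv (greenSol hε hv : ℝ → ℂ) y = _ := fun y hy =>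
    (hasDerivAt_mul_avg_zero hA.continuousOn hy).deriv
  have h2 : (fun t => (p ε t : ℂ) * deriv (greenSol hε hv : ℝ → ℂ) t) =ᶠ[nhds x]
      fun y => ((1 - y) ^ (1 / ε + 1)) •
        avgOne (1 / ε) (fun y => (1 + y) ^ (-(1 / ε)) • v y) y := by
    filter_upwards [isOpen_Ioo.mem_nhds hx] with y hy
    rw [h1 y hy]
    exact p_mul_rpow_smul hy _
  have hw : (w ε x : ℂ) ≠ 0 := Complex.ofReal_ne_zero.2 (w_pos hx).ne'
  rw [slExpr, h2.deriv_eq, (hasDerivAt_rpow_mul_avgOne ha hK.continuousOn hx).deriv, smul_smul,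
    ← w_mul_eq hx, Complex.real_smul, mul_neg, neg_neg, Complex.ofReal_mul, mul_assoc,
    inv_mul_cancel_left₀ hw]

/-- Hadamard's lemma writes `g = x v` with `v` the average of `g'`, hence smooth; `greenSol` then
solves `L f = x v`. -/
theorem exists_slL2_eq_toL2 {ε : ℝ} (hε : 0 < ε) (g : smoothZero) :
    ∃ f : smoothZero, slL2 hε f = toL2 hε g := by
  have hd : ContDiffOn ℝ ∞ (derivWithin (g : ℝ → ℂ) (Icc 0 1)) (Icc 0 1) :=
    g.2.1.derivWithin (uniqueDiffOn_Icc one_pos) (by simp)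
  have hv : ContDiffOn ℝ ∞ (avg 0 (derivWithin (g : ℝ → ℂ) (Icc 0 1))) (Icc 0 1) :=
    contDiffOn_infty.2 fun k => contDiffOn_avg k le_rfl one_pos (contDiffOn_infty.1 hd k)
  refine ⟨greenSol hε hv, ?_⟩
  refine (MemLp.toLp_eq_toLp_iff (memLp_slExpr hε (greenSol hε hv).2) (memLp_self hε g.2)).2
    (ae_weightMeasure fun x hx => ?_)
  rw [slExpr_greenSol hε hv hx]
  have h := rpow_mul_avg (b := 0) (derivWithin (g : ℝ → ℂ) (Icc 0 1)) hx.1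
  have hs : Icc 0 x ⊆ Icc (0 : ℝ) 1 := Icc_subset_Icc_right hx.2.le
  rw [zero_add, Real.rpow_one, Complex.real_smul] at h
  rw [h]
  simp only [Real.rpow_zero, one_smul]
  rw [intervalIntegral.integral_eq_sub_of_hasDerivAt_of_le hx.1.le
      (g.2.1.continuousOn.mono hs) (fun t ht => ?_)
      (hd.continuousOn.mono (by rwa [uIcc_of_le hx.1.le])).intervalIntegrable, g.2.2, sub_zero]
  have ht' : t ∈ Ioo (0 : ℝ) 1 := ⟨ht.1, ht.2.trans hx.2⟩
  rw [derivWithin_eqOn _ ht']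
  exact (differentiableAt_of_mem g.2 ht').hasDerivAt

theorem continuousOn_w (ε : ℝ) : ContinuousOn (w ε) (Ioo 0 1) := by
  refine ContinuousOn.mul (ContinuousOn.mul ?_ ?_) ?_
  · exact continuousOn_id.inv₀ fun x hx => hx.1.ne'
  · exact (continuous_const.sub continuous_id).continuousOn.rpow_const
      fun x hx => Or.inl (by have := hx.2; simp only [id]; linarith : (0 : ℝ) < 1 - id x).ne'
  · exact (continuous_const.add continuous_id).continuousOn.rpow_const
      fun x hx => Or.inl (by have := hx.1; simp only [id]; linarith : (0 : ℝ) < 1 + id x).ne'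

theorem locallyIntegrableOn_w_smul {ε : ℝ} (u : WeightedL2 ε) :
    LocallyIntegrableOn (fun x => w ε x • u x) (Ioo 0 1) := by
  rw [locallyIntegrableOn_iff isOpen_Ioo.isLocallyClosed]
  intro K hK hKc
  have h1 : IntegrableOn (w ε) K := ((continuousOn_w ε).mono hK).integrableOn_compact hKc
  have h2 : IntegrableOn (fun x => w ε x • ‖u x‖ ^ 2) K :=
    (integrable_weightMeasure_iff.1
      ((memLp_two_iff_integrable_sq_norm (Lp.aestronglyMeasurable u)).1 (Lp.memLp u))).mono_set hK
  refine (h1.add h2).mono' ((measurable_w ε).aestronglyMeasurable.smul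
    (Lp.stronglyMeasurable u).aestronglyMeasurable)
    (ae_restrict_of_forall_mem hKc.measurableSet fun x hx => ?_)
  have hw := w_pos (ε := ε) (hK hx)
  rw [norm_smul, Real.norm_of_nonneg hw.le]
  simp only [Pi.add_apply, smul_eq_mul]
  nlinarith [sq_nonneg (‖u x‖ - 1), norm_nonneg (u x)]

/-- If `u` is orthogonal to the range, then `w u` annihilates all test functions supported in `(0,
1)`, so it vanishes almost everywhere there, and `w > 0`. -/
theorem denseRange_toL2 {ε : ℝ} (hε : 0 < ε) : DenseRange (toL2 hε) := by
  have key : (LinearMap.range (toL2 hε)).topologicalClosure = ⊤ := by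
    rw [Submodule.topologicalClosure_eq_top_iff, Submodule.eq_bot_iff]
    intro u hu
    have h0 := isOpen_Ioo.ae_eq_zero_of_integral_contDiff_smul_eq_zero
      (locallyIntegrableOn_w_smul u) fun g hg hgc hgs => ?_
    · refine (Lp.eq_zero_iff_ae_eq_zero).2 ?_
      rw [← ae_restrict_iff' measurableSet_Ioo] at h0
      refine (withDensity_absolutelyContinuous _ _).ae_le ?_
      filter_upwards [h0, ae_restrict_mem measurableSet_Ioo] with x hx hmem
      exact (smul_eq_zero.1 hx).resolve_left (w_pos hmem).ne'
    · have hgz : ∀ x, x ∉ Ioo (0 : ℝ) 1 → g x = 0 := fun x hx =>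
        image_eq_zero_of_notMem_tsupport fun h => hx (hgs h)
      let f : smoothZero := ⟨fun x => (g x : ℂ), (Complex.ofRealCLM.contDiff.comp hg).contDiffOn,
        by simp [hgz 0 (by simp)]⟩
      have hi : inner ℂ (toL2 hε f) u = 0 :=
        (Submodule.mem_orthogonal _ _).1 hu _ (LinearMap.mem_range_self _ f)
      have he : inner ℂ (toL2 hε f) u = ∫ x in Ioo (0 : ℝ) 1, w ε x • (u x * (g x : ℂ)) := by
        rw [← integral_weightMeasure, L2.inner_def]
        refine integral_congr_ae ?_
        filter_upwards [(memLp_self hε f.2).coeFn_toLp] with x hx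
        simp only [toL2, LinearMap.coe_mk, AddHom.coe_mk, hx, RCLike.inner_apply]
        rw [Complex.conj_ofReal]
      rw [hi] at he
      rw [← setIntegral_eq_integral_of_forall_compl_eq_zero (s := Ioo (0 : ℝ) 1)
        fun x hx => by rw [hgz x hx, zero_smul], he]
      refine setIntegral_congr_fun measurableSet_Ioo fun x _ => ?_
      simp only [Complex.real_smul]
      ring
  intro y
  have : y ∈ (LinearMap.range (toL2 hε)).topologicalClosure := by rw [key]; trivial
  simpa using! this

theorem denseRange_slL2 {ε : ℝ} (hε : 0 < ε) : DenseRange (slL2 hε) := by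
  refine (denseRange_toL2 hε).mono ?_
  rintro _ ⟨g, rfl⟩
  obtain ⟨f, hf⟩ := exists_slL2_eq_toL2 hε g
  exact ⟨f, hf⟩

/-- If `G` inverts `L` on smooth functions then `G` is the integral operator with the Green
kernel. -/
theorem ae_eq_integral_kern {ε : ℝ} (hε : 0 < ε) {G : WeightedL2 ε →L[ℂ] WeightedL2 ε}
    (hG : ∀ f : smoothZero, G (slL2 hε f) = toL2 hε f) (u : WeightedL2 ε) :
    ∀ᵐ x ∂(weightMeasure ε), G u x = ∫ y in Ioo 0 1, w ε y • (kern ε x y * u y) := by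
  obtain ⟨z, hz, hlim⟩ := mem_closure_iff_seq_limit.1 (denseRange_slL2 hε u)
  choose f hf using hz
  have hGlim : Filter.Tendsto (fun n => toL2 hε (f n)) Filter.atTop (nhds (G u)) := by
    have := (G.continuous.tendsto u).comp hlim
    refine this.congr fun n => ?_
    rw [Function.comp_apply, ← hf n, hG]
  -- With `L f_n → u`, a subsequence of `f_n` tends to `G u` almost everywhere, while `f_n x = ⟨k_x,
  -- L f_n⟩` tends to `⟨k_x, u⟩` for every `x`.
  obtain ⟨ns, hns, hae⟩ := (tendstoInMeasure_of_tendsto_Lp hGlim).exists_seq_tendsto_ae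
  have hrep : ∀ᵐ x ∂(weightMeasure ε), ∀ n, toL2 hε (f n) x = (f n : ℝ → ℂ) x :=
    ae_all_iff.2 fun n => (memLp_self hε (f n).2).coeFn_toLp
  filter_upwards [hae, hrep, ae_weightMeasure (ε := ε) fun x hx => hx] with x h1 h2 hx
  have h3 : Filter.Tendsto (fun n => inner ℂ (kernL2 hε hx) (z (ns n))) Filter.atTop
      (nhds (inner ℂ (kernL2 hε hx) u)) :=
    ((continuous_const.inner continuous_id).tendsto u).comp (hlim.comp hns.tendsto_atTop)
  rw [← inner_kernL2 hε hx]
  refine tendsto_nhds_unique h1 (h3.congr fun n => ?_)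
  rw [← hf, inner_kernL2_slL2, h2]

/-! ### Improving the growth bound at the end-point `1` -/

theorem integrableOn_one_sub_rpow :
    IntegrableOn (fun y : ℝ => (1 - y) ^ (-(1 / 2) : ℝ)) (Ioo 0 1) := by
  rw [← integrableOn_Ioc_iff_integrableOn_Ioo,
    ← intervalIntegrable_iff_integrableOn_Ioc_of_le zero_le_one]
  have h := (intervalIntegral.intervalIntegrable_rpow' (a := 0) (b := 1)
    (r := (-(1 / 2) : ℝ)) (by norm_num)).comp_sub_left 1
  simpa using h.symm

theorem integrableOn_rpow_neg_half : IntegrableOn (fun y : ℝ => y ^ (-(1 / 2) : ℝ)) (Ioo 0 1) := by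
  rw [← integrableOn_Ioc_iff_integrableOn_Ioo,
    ← intervalIntegrable_iff_integrableOn_Ioc_of_le zero_le_one]
  exact intervalIntegral.intervalIntegrable_rpow' (by norm_num)

/-- One step of the improvement of the growth bound at the singular end-point `1`. -/
theorem exists_bound_of_bound {ε : ℝ} (hε : 0 < ε) {φ : ℝ → ℂ} {μ : ℂ}
    (hφ : ∀ x ∈ Ioo (0 : ℝ) 1, φ x = μ * ∫ y in Ioo 0 1, w ε y • (kern ε x y * φ y))
    {σ θ C : ℝ} (hC : 0 ≤ C) (hb : ∀ x ∈ Ioo (0 : ℝ) 1, ‖φ x‖ ≤ C * pInt ε x ^ σ)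
    (hθ0 : 0 ≤ θ) (hθ1 : θ ≤ 1) (hθσ : θ ≤ σ) (hσθ : (σ - θ) * (1 / ε) ≤ 1 / 2) :
    ∃ C', 0 ≤ C' ∧ ∀ x ∈ Ioo (0 : ℝ) 1, ‖φ x‖ ≤ C' * pInt ε x ^ θ := by
  obtain ⟨C₀, hC₀, hw⟩ := exists_w_mul_pInt_le hε
  obtain ⟨C₁, hC₁, hP⟩ := exists_pInt_le hε
  set D := C * C₀ * C₁ ^ (σ - θ) with hD
  have hD0 : 0 ≤ D := by positivity
  set I := ∫ y in Ioo (0 : ℝ) 1, (1 - y) ^ (-(1 / 2) : ℝ) with hI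
  have hI0 : 0 ≤ I := setIntegral_nonneg measurableSet_Ioo fun y hy =>
    Real.rpow_nonneg (by linarith [hy.2]) _
  refine ⟨‖μ‖ * (D * I), by positivity, fun x hx => ?_⟩
  have hPx := pInt_pos hε hx
  have hle : ‖∫ y in Ioo 0 1, w ε y • (kern ε x y * φ y)‖ ≤
      ∫ y in Ioo (0 : ℝ) 1, pInt ε x ^ θ * D * (1 - y) ^ (-(1 / 2) : ℝ) := by
    refine norm_integral_le_of_norm_le (integrableOn_one_sub_rpow.const_mul _)
      (ae_restrict_of_forall_mem measurableSet_Ioo fun y hy => ?_)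
    have hwy := w_pos (ε := ε) hy
    have hPy := pInt_pos hε hy
    have h1y : 0 < 1 - y := by linarith [hy.2]
    have hm : min x y ∈ Ioo (0 : ℝ) 1 := ⟨lt_min hx.1 hy.1, (min_le_left _ _).trans_lt hx.2⟩
    have hPm := pInt_pos hε hm
    rw [norm_smul, norm_mul, Real.norm_of_nonneg hwy.le, norm_kern hε hx hy]
    -- Interpolation between the two bounds of the kernel: the power `θ` of `P(x)` goes out of the
    -- integral; in `y` there remain `w P`, which is bounded, and `P ^ (σ - θ)`.
    have e1 : pInt ε (min x y) ≤ pInt ε x ^ θ * pInt ε y ^ (1 - θ) := by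
      calc pInt ε (min x y) = pInt ε (min x y) ^ θ * pInt ε (min x y) ^ (1 - θ) := by
            rw [← Real.rpow_add hPm, add_sub_cancel, Real.rpow_one]
        _ ≤ _ := by
            have h1 : 0 ≤ 1 - θ := by linarith
            gcongr
            · exact pInt_min_le_left hε hx hy
            · exact pInt_min_le_right hε hx hy
    -- As `P` grows at most like `(1 - y) ^ (-1/ε)`, the hypothesis `hσθ` keeps the singularity
    -- integrable.
    have e2 : pInt ε y ^ (σ - θ) ≤ C₁ ^ (σ - θ) * (1 - y) ^ (-(1 / 2) : ℝ) := by
      calc pInt ε y ^ (σ - θ) ≤ (C₁ * (1 - y) ^ (-(1 / ε))) ^ (σ - θ) := by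
            have h1 : 0 ≤ σ - θ := by linarith
            gcongr
            exact hP y hy
        _ = C₁ ^ (σ - θ) * (1 - y) ^ (-(1 / ε) * (σ - θ)) := by
            rw [Real.mul_rpow hC₁.le (Real.rpow_nonneg h1y.le _), ← Real.rpow_mul h1y.le]
        _ ≤ _ := by
            gcongr ?_ * ?_
            exact Real.rpow_le_rpow_of_exponent_ge h1y (by linarith [hy.1]) (by linarith)
    calc w ε y * (pInt ε (min x y) * ‖φ y‖)
        ≤ w ε y * ((pInt ε x ^ θ * pInt ε y ^ (1 - θ)) * (C * pInt ε y ^ σ)) := by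
          gcongr
          exact hb y hy
      _ = pInt ε x ^ θ * C * (w ε y * (pInt ε y ^ (1 - θ) * pInt ε y ^ σ)) := by ring
      _ = pInt ε x ^ θ * C * (w ε y * pInt ε y) * pInt ε y ^ (σ - θ) := by
          rw [← Real.rpow_add hPy, show 1 - θ + σ = 1 + (σ - θ) by ring, Real.rpow_add hPy,
            Real.rpow_one]
          ring
      _ ≤ pInt ε x ^ θ * C * C₀ * (C₁ ^ (σ - θ) * (1 - y) ^ (-(1 / 2) : ℝ)) := by
          gcongr
          exact hw y hy
      _ = pInt ε x ^ θ * D * (1 - y) ^ (-(1 / 2) : ℝ) := by rw [hD]; ring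
  rw [integral_const_mul] at hle
  rw [hφ x hx, norm_mul]
  calc ‖μ‖ * _ ≤ ‖μ‖ * (pInt ε x ^ θ * D * I) := by gcongr
    _ = _ := by ring

/-- Each step may lower the exponent of `P` by `ε / 2`. Starting from `1/2`, it reaches `0` after `n
≥ 1 / ε` steps. -/
theorem exists_bound {ε : ℝ} (hε : 0 < ε) {φ : ℝ → ℂ} {μ : ℂ}
    (hφ : ∀ x ∈ Ioo (0 : ℝ) 1, φ x = μ * ∫ y in Ioo 0 1, w ε y • (kern ε x y * φ y))
    {C : ℝ} (hC : 0 ≤ C) (hb : ∀ x ∈ Ioo (0 : ℝ) 1, ‖φ x‖ ≤ C * pInt ε x ^ (1 / 2 : ℝ)) :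
    ∃ B, 0 ≤ B ∧ ∀ x ∈ Ioo (0 : ℝ) 1, ‖φ x‖ ≤ B := by
  have key : ∀ n : ℕ, ∃ B, 0 ≤ B ∧
      ∀ x ∈ Ioo (0 : ℝ) 1, ‖φ x‖ ≤ B * pInt ε x ^ (max 0 (1 / 2 - n * (ε / 2))) := by
    intro n
    induction n with
    | zero => exact ⟨C, hC, by simpa using hb⟩
    | succ n ih =>
      obtain ⟨B, hB, h⟩ := ih
      have hn : (0 : ℝ) ≤ n * (ε / 2) := by positivity
      refine exists_bound_of_bound hε hφ hB h (le_max_left _ _) (max_le zero_le_one ?_)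
        (max_le_max_left 0 ?_) ?_
      · push_cast
        linarith
      · push_cast
        linarith
      · rw [← le_div_iff₀ (by positivity), div_div_eq_mul_div, div_one, sub_le_iff_le_add]
        refine max_le (by positivity) ?_
        have := le_max_right 0 (1 / 2 - ((n + 1 : ℕ) : ℝ) * (ε / 2))
        push_cast at this ⊢
        linarith
  obtain ⟨n, hn⟩ := exists_nat_ge (1 / ε)
  obtain ⟨B, hB, h⟩ := key n
  refine ⟨B, hB, fun x hx => ?_⟩
  have : max 0 (1 / 2 - n * (ε / 2)) = 0 := by
    refine max_eq_left ?_
    rw [div_le_iff₀ hε] at hn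
    linarith
  simpa only [this, Real.rpow_zero, mul_one] using h x hx

/-- `w P ^ (1/2) = (w P) ^ (1/2) * w ^ (1/2)`, where `w P` is bounded and `w ≤ 1 / y`, so `y ^
(-1/2)` dominates. Boundedness of `φ` alone would not suffice, as `w` has a pole at `0`. -/
theorem integrableOn_w_smul {ε : ℝ} (hε : 0 < ε) {φ : ℝ → ℂ}
    (hm : AEStronglyMeasurable φ (volume.restrict (Ioo 0 1)))
    {C : ℝ} (hb : ∀ x ∈ Ioo (0 : ℝ) 1, ‖φ x‖ ≤ C * pInt ε x ^ (1 / 2 : ℝ)) :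
    IntegrableOn (fun y => w ε y • φ y) (Ioo 0 1) := by
  obtain ⟨C₀, hC₀, hw⟩ := exists_w_mul_pInt_le hε
  refine Integrable.mono' (integrableOn_rpow_neg_half.const_mul (|C| * C₀ ^ (1 / 2 : ℝ)))
    ((measurable_w ε).aestronglyMeasurable.smul hm)
    (ae_restrict_of_forall_mem measurableSet_Ioo fun y hy => ?_)
  have hwy := w_pos (ε := ε) hy
  have hPy := pInt_pos hε hy
  have hy0 := hy.1
  have h1 : w ε y ≤ y⁻¹ := by
    rw [← one_div, le_div_iff₀ hy.1]
    exact w_mul_le hε hy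
  rw [norm_smul, Real.norm_of_nonneg hwy.le]
  calc w ε y * ‖φ y‖ ≤ w ε y * (|C| * pInt ε y ^ (1 / 2 : ℝ)) := by
        gcongr
        refine (hb y hy).trans ?_
        gcongr
        exact le_abs_self C
    _ = |C| * ((w ε y ^ (1 / 2 : ℝ) * pInt ε y ^ (1 / 2 : ℝ)) * w ε y ^ (1 / 2 : ℝ)) := by
        have : w ε y = w ε y ^ (1 / 2 : ℝ) * w ε y ^ (1 / 2 : ℝ) := by
          rw [← Real.rpow_add hwy]; norm_num
        nth_rewrite 1 [this]
        ring
    _ ≤ |C| * (C₀ ^ (1 / 2 : ℝ) * y⁻¹ ^ (1 / 2 : ℝ)) := by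
        rw [← Real.mul_rpow hwy.le hPy.le]
        gcongr
        exact hw y hy
    _ = |C| * C₀ ^ (1 / 2 : ℝ) * y ^ (-(1 / 2) : ℝ) := by
        rw [Real.inv_rpow hy.1.le, ← Real.rpow_neg hy.1.le, mul_assoc]

theorem intervalIntegrable_of_integrableOn_Ioo {g : ℝ → ℂ} (hg : IntegrableOn g (Ioo 0 1)) {s t : ℝ}
    (hs : s ∈ Icc (0 : ℝ) 1) (ht : t ∈ Icc (0 : ℝ) 1) : IntervalIntegrable g volume s t := by
  rw [← integrableOn_Ioc_iff_integrableOn_Ioo,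
    ← intervalIntegrable_iff_integrableOn_Ioc_of_le zero_le_one] at hg
  refine hg.mono_set ?_
  rw [uIcc_of_le zero_le_one]
  exact OrdConnected.uIcc_subset ordConnected_Icc hs ht

theorem continuousOn_primitive {g : ℝ → ℂ} (hg : IntegrableOn g (Ioo 0 1)) :
    ContinuousOn (fun x => ∫ y in (0 : ℝ)..x, g y) (Icc 0 1) := by
  have := intervalIntegral.continuousOn_primitive_interval (μ := volume) (a := 0) (b := 1) (f := g)
    (by rwa [uIcc_of_le zero_le_one, integrableOn_Icc_iff_integrableOn_Ioo])
  rwa [uIcc_of_le zero_le_one] at this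

theorem continuousOn_primitive_right {g : ℝ → ℂ} (hg : IntegrableOn g (Ioo 0 1)) :
    ContinuousOn (fun x => ∫ y in x..(1 : ℝ), g y) (Icc 0 1) := by
  refine (continuousOn_const (c := ∫ y in (0 : ℝ)..1, g y)).sub (continuousOn_primitive hg)
    |>.congr fun x hx => ?_
  rw [Pi.sub_apply, eq_sub_iff_add_eq', intervalIntegral.integral_add_adjacent_intervals
    (intervalIntegrable_of_integrableOn_Ioo hg (left_mem_Icc.2 zero_le_one) hx)
    (intervalIntegrable_of_integrableOn_Ioo hg hx (right_mem_Icc.2 zero_le_one))]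

/-! ### Smoothness of solutions of the integral equation -/

/-- The continuous function `p⁻¹ ∫ₓ¹ w φ`, which is `f'` when `-w⁻¹ (p f')' = φ`. -/
def greenDeriv (ε : ℝ) (φ : ℝ → ℂ) (x : ℝ) : ℂ := (p ε x)⁻¹ • ∫ y in x..(1 : ℝ), w ε y • φ y

theorem continuousOn_greenDeriv {ε : ℝ} (hε : 0 < ε) {φ : ℝ → ℂ}
    (hi : IntegrableOn (fun y => w ε y • φ y) (Ioo 0 1)) :
    ContinuousOn (greenDeriv ε φ) (Ico 0 1) :=
  (((continuousOn_p hε).mono Ico_subset_Icc_self).inv₀ fun _ hx => (p_pos hx).ne').smul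
    ((continuousOn_primitive_right hi).mono Ico_subset_Icc_self)

/-- Splitting the kernel at `y = x` gives `φ = μ (∫₀ˣ w P φ + P(x) ∫ₓ¹ w φ)`. This makes `φ`
continuous; on differentiating, the two terms `w P φ` cancel and only `P' = 1 / p` contributes. -/
theorem eq_mul_integral_greenDeriv {ε : ℝ} (hε : 0 < ε) {φ : ℝ → ℂ} {μ : ℂ}
    (hm : AEStronglyMeasurable φ (volume.restrict (Ioo 0 1)))
    (hφ : ∀ x ∈ Ioo (0 : ℝ) 1, φ x = μ * ∫ y in Ioo 0 1, w ε y • (kern ε x y * φ y))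
    (hi : IntegrableOn (fun y => w ε y • φ y) (Ioo 0 1))
    {B : ℝ} (hB : ∀ x ∈ Ioo (0 : ℝ) 1, ‖φ x‖ ≤ B) {x : ℝ} (hx : x ∈ Ioo (0 : ℝ) 1) :
    φ x = μ * ∫ t in (0 : ℝ)..x, greenDeriv ε φ t := by
  obtain ⟨C₀, hC₀, hw⟩ := exists_w_mul_pInt_le hε
  have h0B : 0 ≤ B := (norm_nonneg _).trans (hB x hx)
  have hPm : AEStronglyMeasurable (fun y => (pInt ε y : ℂ)) (volume.restrict (Ioo (0 : ℝ) 1)) :=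
    (Complex.continuous_ofReal.comp_continuousOn ((continuousOn_pInt hε).mono
      Ioo_subset_Ico_self)).aestronglyMeasurable measurableSet_Ioo
  have hi' : IntegrableOn (fun y => w ε y • ((pInt ε y : ℂ) * φ y)) (Ioo 0 1) := by
    refine Integrable.mono' (g := fun _ => C₀ * B) (integrableOn_const (by simp))
      ((measurable_w ε).aestronglyMeasurable.smul (hPm.mul hm))
      (ae_restrict_of_forall_mem measurableSet_Ioo fun y hy => ?_)
    have hwy := w_pos (ε := ε) hy
    have hPy := pInt_pos hε hy
    rw [norm_smul, norm_mul, Real.norm_of_nonneg hwy.le, Complex.norm_real,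
      Real.norm_of_nonneg hPy.le, ← mul_assoc]
    gcongr
    exacts [hw y hy, hB y hy]
  set ψ : ℝ → ℂ := fun x => μ * ((∫ y in (0 : ℝ)..x, w ε y • ((pInt ε y : ℂ) * φ y)) +
    (pInt ε x : ℂ) * ∫ y in x..(1 : ℝ), w ε y • φ y) with hψ
  have hψφ : ∀ x ∈ Ioo (0 : ℝ) 1, φ x = ψ x := by
    intro x hx
    have hik : IntegrableOn (fun y => w ε y • (kern ε x y * φ y)) (Ioo 0 1) := by
      refine Integrable.mono' (hi.norm.const_mul (pInt ε x))
        ((measurable_w ε).aestronglyMeasurable.smul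
          (((continuousOn_kern hε hx).aestronglyMeasurable measurableSet_Ioo).mul hm))
        (ae_restrict_of_forall_mem measurableSet_Ioo fun y hy => ?_)
      have hwy := w_pos (ε := ε) hy
      rw [norm_smul, norm_smul, norm_mul, Real.norm_of_nonneg hwy.le, norm_kern hε hx hy,
        mul_left_comm]
      gcongr
      exact pInt_min_le_left hε hx hy
    rw [hφ x hx, (integral_Ioo_split hik hx).2.2, hψ]
    congr 2
    · refine intervalIntegral.integral_congr fun y hy => ?_
      rw [uIcc_of_le hx.1.le] at hy
      simp only [kern, min_eq_right hy.2]
    · rw [← intervalIntegral.integral_const_mul]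
      refine intervalIntegral.integral_congr fun y hy => ?_
      rw [uIcc_of_le hx.2.le] at hy
      simp only [kern, min_eq_left hy.1, Complex.real_smul]
      ring
  have hPc : ContinuousOn (fun y => (pInt ε y : ℂ)) (Ico 0 1) :=
    Complex.continuous_ofReal.comp_continuousOn (continuousOn_pInt hε)
  have hψc : ContinuousOn ψ (Ico 0 1) :=
    continuousOn_const.mul (((continuousOn_primitive hi').mono Ico_subset_Icc_self).add
      (hPc.mul ((continuousOn_primitive_right hi).mono Ico_subset_Icc_self)))
  have hφc : ContinuousOn φ (Ioo 0 1) := (hψc.mono Ioo_subset_Ico_self).congr hψφ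
  have hwc : ContinuousOn (fun y => w ε y • φ y) (Ioo 0 1) := (continuousOn_w ε).smul hφc
  have hwc' : ContinuousOn (fun y => w ε y • ((pInt ε y : ℂ) * φ y)) (Ioo 0 1) :=
    (continuousOn_w ε).smul ((hPc.mono Ioo_subset_Ico_self).mul hφc)
  have hψd : ∀ t ∈ Ioo (0 : ℝ) 1, HasDerivAt ψ (μ * greenDeriv ε φ t) t := by
    intro t ht
    have hn := isOpen_Ioo.mem_nhds ht
    have htI := Ioo_subset_Icc_self ht
    have d1 := intervalIntegral.integral_hasDerivAt_right
      (intervalIntegrable_of_integrableOn_Ioo hi' (left_mem_Icc.2 zero_le_one) htI)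
      (hwc'.stronglyMeasurableAtFilter isOpen_Ioo t ht) (hwc'.continuousAt hn)
    have d2 := intervalIntegral.integral_hasDerivAt_left
      (intervalIntegrable_of_integrableOn_Ioo hi htI (right_mem_Icc.2 zero_le_one))
      (hwc.stronglyMeasurableAtFilter isOpen_Ioo t ht) (hwc.continuousAt hn)
    refine ((d1.add ((hasDerivAt_pInt hε (Ioo_subset_Ico_self ht)).ofReal_comp.mul d2)).const_mul
      μ).congr_deriv ?_
    simp only [greenDeriv, Complex.real_smul]
    ring
  have hs : Icc 0 x ⊆ Ico (0 : ℝ) 1 := fun t ht => ⟨ht.1, ht.2.trans_lt hx.2⟩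
  have h := intervalIntegral.integral_eq_sub_of_hasDerivAt_of_le hx.1.le (hψc.mono hs)
    (fun t ht => hψd t ⟨ht.1, ht.2.trans hx.2⟩)
    ((continuousOn_const.mul ((continuousOn_greenDeriv hε hi).mono
      (by rwa [uIcc_of_le hx.1.le]))).intervalIntegrable)
  rw [intervalIntegral.integral_const_mul] at h
  rw [h, hψφ x hx, hψ]
  simp [pInt_zero]

/-- Near `1`, the integral of `w φ` over `(x, 1)` is `O((1 - x) ^ (1 + 1/ε))`, exactly the order to
which `p` vanishes. -/
theorem exists_norm_greenDeriv_le {ε : ℝ} (hε : 0 < ε) {φ : ℝ → ℂ}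
    (hi : IntegrableOn (fun y => w ε y • φ y) (Ioo 0 1))
    {B : ℝ} (hB0 : 0 ≤ B) (hB : ∀ x ∈ Ioo (0 : ℝ) 1, ‖φ x‖ ≤ B) :
    ∃ M, ∀ x ∈ Ico (0 : ℝ) 1, ‖greenDeriv ε φ x‖ ≤ M := by
  obtain ⟨M₁, h₁⟩ := (isCompact_Icc (a := (0 : ℝ)) (b := 1 / 2)).exists_bound_of_continuousOn
    ((continuousOn_greenDeriv hε hi).mono fun x hx => ⟨hx.1, by linarith [hx.2]⟩)
  obtain ⟨M₂, h₂⟩ := (isCompact_Icc (a := (0 : ℝ)) (b := 1)).exists_bound_of_continuousOn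
    (contDiffOn_one_add_rpow 0 (1 / ε - 1)).continuousOn
  refine ⟨max M₁ (2 * B * M₂), fun x hx => ?_⟩
  rcases le_or_gt x (1 / 2) with h | h
  · exact (h₁ x ⟨hx.1, h⟩).trans (le_max_left _ _)
  · refine le_trans ?_ (le_max_right _ _)
    have h1x : 0 < 1 - x := by linarith [hx.2]
    have h2x : 0 < 1 + x := by linarith
    have ha : 0 < 1 / ε := by positivity
    have hF : ‖∫ y in x..(1 : ℝ), w ε y • φ y‖ ≤ 2 * (1 - x) ^ (1 / ε) * B * |1 - x| := by
      refine intervalIntegral.norm_integral_le_of_norm_le_const_ae (Filter.Eventually.of_forall ?_)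
      intro y hy
      rw [uIoc_of_le hx.2.le] at hy
      rcases hy.2.eq_or_lt with rfl | hy1
      · simp only [w, sub_self, Real.zero_rpow ha.ne', mul_zero, zero_mul, zero_smul, norm_zero]
        positivity
      · have hy' : y ∈ Ioo (0 : ℝ) 1 := ⟨by linarith [hy.1], hy1⟩
        have hwy := w_pos (ε := ε) hy'
        have h1y : 0 < 1 - y := by linarith
        have h2y : 0 < 1 + y := by linarith [hy'.1]
        rw [norm_smul, Real.norm_of_nonneg hwy.le]
        gcongr
        · rw [w]
          -- The constant `2` comes from `y > x > 1/2`.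
          have b0 : y⁻¹ ≤ 2 := by
            rw [inv_le_comm₀ hy'.1 two_pos]
            linarith [hy.1]
          have b1 : (1 - y) ^ (1 / ε) ≤ (1 - x) ^ (1 / ε) :=
            Real.rpow_le_rpow h1y.le (by linarith [hy.1]) ha.le
          have b2 : (1 + y) ^ (-(1 / ε)) ≤ 1 :=
            Real.rpow_le_one_of_one_le_of_nonpos (by linarith [hy'.1]) (by linarith)
          calc _ ≤ 2 * (1 - x) ^ (1 / ε) * 1 := by
                gcongr
            _ = _ := mul_one _
        · exact hB y hy'
    rw [abs_of_pos h1x] at hF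
    have hpx : (p ε x)⁻¹ * ((1 - x) ^ (1 / ε) * (1 - x)) = (1 + x) ^ (1 / ε - 1) := by
      rw [p, ← neg_sub (1 : ℝ) (1 / ε), Real.rpow_neg h2x.le, add_comm, Real.rpow_add h1x,
        Real.rpow_one]
      have e1 := (Real.rpow_pos_of_pos h1x (1 / ε)).ne'
      have e2 := (Real.rpow_pos_of_pos h2x (1 - 1 / ε)).ne'
      field_simp
    have hp := p_pos (ε := ε) hx
    rw [greenDeriv, norm_smul, norm_inv, Real.norm_of_nonneg hp.le]
    calc (p ε x)⁻¹ * ‖∫ y in x..(1 : ℝ), w ε y • φ y‖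
        ≤ (p ε x)⁻¹ * (2 * (1 - x) ^ (1 / ε) * B * (1 - x)) := by gcongr
      _ = 2 * B * ((p ε x)⁻¹ * ((1 - x) ^ (1 / ε) * (1 - x))) := by ring
      _ ≤ 2 * B * M₂ := by
          rw [hpx]
          gcongr
          exact (le_abs_self _).trans (h₂ x ⟨hx.1, hx.2.le⟩)

/-- Since `s x < 1` for `s < 1`, dominated convergence gives continuity even at `x = 1`, where `g`
need not be continuous. -/
theorem continuousOn_avg_of_bounded {g : ℝ → ℂ} (hg : ContinuousOn g (Ico 0 1)) {M : ℝ}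
    (hM : ∀ x ∈ Ico (0 : ℝ) 1, ‖g x‖ ≤ M) : ContinuousOn (avg 0 g) (Icc 0 1) := by
  have hmem : ∀ x ∈ Icc (0 : ℝ) 1, ∀ s ∈ Ioo (0 : ℝ) 1, s * x ∈ Ico (0 : ℝ) 1 := fun x hx s hs =>
    ⟨mul_nonneg hs.1.le hx.1, (mul_le_of_le_one_right hs.1.le hx.2).trans_lt hs.2⟩
  have heq : avg 0 g = fun x => ∫ s in Ioo (0 : ℝ) 1, g (s * x) := by
    funext x
    rw [avg, intervalIntegral.integral_of_le zero_le_one, integral_Ioc_eq_integral_Ioo]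
    simp only [Real.rpow_zero, one_smul]
  rw [heq]
  intro x hx
  refine continuousWithinAt_of_dominated (bound := fun _ => M) ?_ ?_ (integrableOn_const (by simp))
    ?_
  · filter_upwards [self_mem_nhdsWithin] with y hy
    exact (hg.comp (continuous_id.mul continuous_const).continuousOn (hmem y hy)).aestronglyMeasurable
      measurableSet_Ioo
  · filter_upwards [self_mem_nhdsWithin] with y hy
    exact ae_restrict_of_forall_mem measurableSet_Ioo fun s hs => hM _ (hmem y hy s hs)
  · refine ae_restrict_of_forall_mem measurableSet_Ioo fun s hs => ?_
    exact hg.comp (continuous_const.mul continuous_id).continuousOn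
      (fun y hy => hmem y hy s hs) x hx

/-- Solutions of the integral equation `φ = μ ∫ P(min(x, y)) φ(y) w(y) dy` are smooth up to both
end-points. -/
theorem exists_contDiffOn_of_integral_eq {ε : ℝ} (hε : 0 < ε) {φ : ℝ → ℂ} {μ : ℂ}
    (hm : AEStronglyMeasurable φ (volume.restrict (Ioo 0 1)))
    (hφ : ∀ x ∈ Ioo (0 : ℝ) 1, φ x = μ * ∫ y in Ioo 0 1, w ε y • (kern ε x y * φ y))
    {C : ℝ} (hC : 0 ≤ C) (hb : ∀ x ∈ Ioo (0 : ℝ) 1, ‖φ x‖ ≤ C * pInt ε x ^ (1 / 2 : ℝ)) :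
    ∃ v : ℝ → ℂ, ContDiffOn ℝ ∞ v (Icc 0 1) ∧ ∀ x ∈ Ioo (0 : ℝ) 1, φ x = x * v x := by
  have ha : 0 ≤ 1 / ε := by positivity
  obtain ⟨B, hB0, hB⟩ := exists_bound hε hφ hC hb
  have hi := integrableOn_w_smul hε hm hb
  obtain ⟨M, hM⟩ := exists_norm_greenDeriv_le hε hi hB0 hB
  set g := greenDeriv ε φ with hg
  set v : ℝ → ℂ := fun x => μ * avg 0 g x with hv
  have hvc : ContinuousOn v (Icc 0 1) :=
    continuousOn_const.mul (continuousOn_avg_of_bounded (continuousOn_greenDeriv hε hi) hM)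
  have hφv : ∀ x ∈ Ioo (0 : ℝ) 1, φ x = x * v x := by
    intro x hx
    have h := rpow_mul_avg (b := 0) g hx.1
    simp only [zero_add, Real.rpow_one, Complex.real_smul, Real.rpow_zero, one_smul] at h
    rw [eq_mul_integral_greenDeriv hε hm hφ hi hB hx, ← h, hv]
    ring
  -- Inserting `φ = y v` and `w y = (1 - y) ^ (1/ε) (1 + y) ^ (-1/ε)` turns `p⁻¹ ∫ w φ` into an
  -- average based at `1`. The equation thus closes up as `v = μ * divGreen v`.
  have hgq : ∀ t ∈ Ico (0 : ℝ) 1, g t =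
      (1 + t) ^ (1 / ε - 1) • avgOne (1 / ε) (fun y => (1 + y) ^ (-(1 / ε)) • v y) t := by
    intro t ht
    have h1t : 0 < 1 - t := by linarith [ht.2]
    have h2t : 0 < 1 + t := by linarith [ht.1]
    have hF : ∫ y in t..(1 : ℝ), w ε y • φ y = ((1 - t) ^ (1 / ε + 1)) •
        avgOne (1 / ε) (fun y => (1 + y) ^ (-(1 / ε)) • v y) t := by
      have h3 := intervalIntegral.integral_comp_sub_left (a := t) (b := 1)
        (fun s => (s ^ (1 / ε)) • ((1 + (1 - s)) ^ (-(1 / ε)) • v (1 - s))) 1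
      rw [avgOne, rpow_mul_avg _ h1t, ← sub_self (1 : ℝ), ← h3,
        intervalIntegral.integral_of_le ht.2.le, intervalIntegral.integral_of_le ht.2.le,
        integral_Ioc_eq_integral_Ioo, integral_Ioc_eq_integral_Ioo]
      refine setIntegral_congr_fun measurableSet_Ioo fun y hy => ?_
      have hy' : y ∈ Ioo (0 : ℝ) 1 := ⟨ht.1.trans_lt hy.1, hy.2⟩
      simp only [sub_sub_cancel, smul_smul]
      rw [← w_mul_eq hy', hφv y hy', mul_smul, Complex.real_smul (x := y)]
    rw [hg, greenDeriv, hF, smul_smul]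
    congr 1
    rw [p, ← neg_sub (1 : ℝ) (1 / ε), Real.rpow_neg h2t.le, add_comm 1 (1 / ε)]
    have e1 := (Real.rpow_pos_of_pos h1t (1 / ε + 1)).ne'
    have e2 := (Real.rpow_pos_of_pos h2t (1 - 1 / ε)).ne'
    field_simp
  refine ⟨v, contDiffOn_of_eqOn_divGreen ha hvc (μ := μ) fun x hx => ?_, hφv⟩
  simp only [hv, divGreen]
  congr 1
  rw [avg, avg, intervalIntegral.integral_of_le zero_le_one,
    intervalIntegral.integral_of_le zero_le_one, integral_Ioc_eq_integral_Ioo,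
    integral_Ioc_eq_integral_Ioo]
  refine setIntegral_congr_fun measurableSet_Ioo fun s hs => ?_
  simp only [hgq (s * x) ⟨mul_nonneg hs.1.le hx.1,
    (mul_le_of_le_one_right hs.1.le hx.2).trans_lt hs.2⟩, hv]

/-- The right-hand side of the integral equation provides a representative `φ` of `u`. As `φ = u`
almost everywhere, replacing `u` by `φ` under the integral does not change it, so `φ` satisfies the
equation at every point. -/
theorem exists_eq_toL2_of_eq_smul {ε : ℝ} (hε : 0 < ε) {G : WeightedL2 ε →L[ℂ] WeightedL2 ε}
    (hG : ∀ f : smoothZero, G (slL2 hε f) = toL2 hε f) {u : WeightedL2 ε} {μ : ℂ}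
    (hu : u = μ • G u) : ∃ f : smoothZero, u = toL2 hε f := by
  set φ : ℝ → ℂ := fun x => μ * ∫ y in Ioo 0 1, w ε y • (kern ε x y * u y) with hφ
  have hae : ∀ᵐ x ∂(weightMeasure ε), u x = φ x := by
    have h1 : ∀ᵐ x ∂(weightMeasure ε), u x = μ • G u x := by
      have := Lp.coeFn_smul μ (G u)
      rwa [← hu] at this
    filter_upwards [h1, ae_eq_integral_kern hε hG u] with x h1 h2
    rw [h1, h2, smul_eq_mul]
  have hae' := ae_volume_of_ae_weightMeasure hae
  obtain ⟨C, hC, hk⟩ := exists_norm_kernL2_sq_le hε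
  have hreg := exists_contDiffOn_of_integral_eq hε (φ := φ) (μ := μ)
    (C := ‖μ‖ * (C ^ (1 / 2 : ℝ) * ‖u‖))
    ((Lp.stronglyMeasurable u).aestronglyMeasurable.congr hae') (fun x hx => ?_) (by positivity)
    (fun x hx => ?_)
  · obtain ⟨v, hv, hφv⟩ := hreg
    let f : smoothZero := ⟨fun x => (x : ℂ) * v x,
      (Complex.ofRealCLM.contDiff.contDiffOn).mul hv, by simp⟩
    refine ⟨f, Lp.ext ?_⟩
    filter_upwards [hae, (memLp_self hε f.2).coeFn_toLp,
      ae_weightMeasure (ε := ε) fun x hx => hx] with x h1 h2 hx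
    rw [h1, hφv x hx]
    exact h2.symm
  · change μ * _ = _
    congr 1
    refine integral_congr_ae ?_
    filter_upwards [hae'] with y hy
    rw [hy]
  · have hP := pInt_pos hε hx
    have h1 : ‖kernL2 hε hx‖ ≤ C ^ (1 / 2 : ℝ) * pInt ε x ^ (1 / 2 : ℝ) := by
      rw [← Real.mul_rpow hC.le hP.le, ← Real.sqrt_eq_rpow]
      exact Real.le_sqrt_of_sq_le (hk x hx)
    change ‖μ * _‖ ≤ _
    rw [norm_mul, ← inner_kernL2 hε hx]
    calc ‖μ‖ * ‖inner ℂ (kernL2 hε hx) u‖ ≤ ‖μ‖ * (‖kernL2 hε hx‖ * ‖u‖) := by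
          gcongr
          exact norm_inner_le_norm _ _
      _ ≤ ‖μ‖ * ((C ^ (1 / 2 : ℝ) * pInt ε x ^ (1 / 2 : ℝ)) * ‖u‖) := by gcongr
      _ = _ := by ring

/-! ### Unbounded operators with a bounded inverse -/

section Abstract

variable {E : Type*} [NormedAddCommGroup E] [NormedSpace ℂ E]

/-- An operator whose inverse is, on a dense set, the restriction of an injective bounded operator
`G` is closable, and its closure is `G⁻¹`. -/
theorem isClosable_and_mem_closure_graph_iff {T : E →ₗ.[ℂ] E} {G : E →L[ℂ] E}
    (hinj : ∀ y, G y = 0 → y = 0) (hsub : ∀ z ∈ T.graph, z.1 = G z.2)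
    (hdense : Dense {y | (G y, y) ∈ T.graph}) :
    T.IsClosable ∧ ∀ x y, (x, y) ∈ T.closure.graph ↔ x = G y := by
  have hmem : ∀ z : E × E, z ∈ T.graph.topologicalClosure ↔ z.1 = G z.2 := by
    intro z
    constructor
    · intro hz
      have hc : IsClosed {z : E × E | z.1 = G z.2} :=
        isClosed_eq continuous_fst (G.continuous.comp continuous_snd)
      exact closure_minimal (s := (T.graph : Set (E × E))) hsub hc hz
    · intro hz
      obtain ⟨x, y⟩ := z
      obtain rfl : x = G y := hz
      have hcont : Continuous fun y : E => (G y, y) := G.continuous.prodMk continuous_id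
      exact map_mem_closure (f := fun y : E => (G y, y)) (t := (T.graph : Set (E × E))) hcont
        (hdense y) fun _ h => h
  have hcl : T.IsClosable := by
    refine ⟨T.graph.topologicalClosure.toLinearPMap, ?_⟩
    rw [Submodule.toLinearPMap_graph_eq]
    intro z hz h0
    -- The closure of the graph is single-valued exactly because `G` is injective.
    exact hinj _ (((hmem z).1 hz).symm.trans h0)
  refine ⟨hcl, fun x y => ?_⟩
  rw [← hcl.graph_closure_eq_closure_graph, hmem]

/-- If `T = G⁻¹` then `z` belongs to the resolvent set of `T` as soon as `1 - z G` is invertible. -/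
theorem mem_resolventSet_of_isUnit {T : E →ₗ.[ℂ] E} {G : E →L[ℂ] E}
    (hT : ∀ x y, (x, y) ∈ T.graph ↔ x = G y) {z : ℂ} (hz : IsUnit (1 - z • G)) :
    z ∈ resolventSet T := by
  obtain ⟨U, hU⟩ := hz
  have h1 : ∀ y, (U⁻¹ : (E →L[ℂ] E)ˣ).val y - z • G ((U⁻¹ : (E →L[ℂ] E)ˣ).val y) = y := fun y => by
    have := congrArg (fun A : E →L[ℂ] E => A y) U.mul_inv
    simpa [hU] using this
  have h2 : ∀ y, (U⁻¹ : (E →L[ℂ] E)ˣ).val (y - z • G y) = y := fun y => by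
    have := congrArg (fun A : E →L[ℂ] E => A y) U.inv_mul
    simpa [hU] using this
  -- The resolvent is `G (1 - z G)⁻¹`, because `(T - z) G = 1 - z G`.
  refine ⟨G * (U⁻¹ : (E →L[ℂ] E)ˣ).val, fun y => ?_, fun x => ?_⟩
  · obtain ⟨x, hx, hTx⟩ := (T.mem_graph_iff).1 ((hT _ ((U⁻¹ : (E →L[ℂ] E)ˣ).val y)).2 rfl)
    refine ⟨x, hx, ?_⟩
    simp only at hx hTx
    rw [hTx, hx, h1]
  · have hx : (x : E) = G (T x) := (hT _ _).1 (T.mem_graph x)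
    rw [mul_apply_eq_comp]
    have h := h2 (T x)
    rw [← hx] at h
    rw [h, ← hx]

end Abstract

-- For `z ≠ 0`, `1 - z G = z (z⁻¹ - G)`, and `z⁻¹` in the spectrum of a positive operator would
-- force `z > 0`. For `z = 0` the operator is the identity.
open scoped ComplexOrder in
theorem isUnit_one_sub_smul_of_isPositive {H : Type*} [NormedAddCommGroup H]
    [InnerProductSpace ℂ H] [CompleteSpace H] {G : H →L[ℂ] H} (hG : G.IsPositive) {z : ℂ}
    (hz : z ∉ ((↑) : ℝ → ℂ) '' Ioi 0) : IsUnit (1 - z • G) := by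
  rcases eq_or_ne z 0 with rfl | h0
  · simp
  have hs : z⁻¹ ∉ spectrum ℂ G := by
    intro hmem
    have h1 : spectrum ℂ G ⊆ ((↑) : ℝ → ℂ) '' Ici 0 := by
      intro y hy
      obtain ⟨hre, him⟩ := RCLike.nonneg_iff.1 (spectrum_nonneg_of_nonneg
        ((ContinuousLinearMap.nonneg_iff_isPositive G).2 hG) hy)
      exact ⟨y.re, hre, Complex.ext rfl (by simpa using him.symm)⟩
    obtain ⟨r, hr, hrz⟩ := h1 hmem
    refine hz ⟨r⁻¹, mem_Ioi.2 (inv_pos.2 (lt_of_le_of_ne hr ?_)), by simp [hrz]⟩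
    rintro rfl
    exact inv_ne_zero h0 (by simpa using hrz.symm)
  rw [spectrum.notMem_iff, Algebra.algebraMap_eq_smul_one] at hs
  have : (1 : H →L[ℂ] H) - z • G = z • (z⁻¹ • (1 : H →L[ℂ] H) - G) := by
    rw [smul_sub, smul_smul, mul_inv_cancel₀ h0, one_smul]
  rw [this]
  exact hs.smul (Units.mk0 z h0)

/-! ### The bounded inverse of `L` and the conclusion -/

theorem mem_opL_graph_iff {ε : ℝ} (hε : 0 < ε) (z : WeightedL2 ε × WeightedL2 ε) :
    z ∈ (opL hε).graph ↔ ∃ f : smoothZero, z = (toL2 hε f, slL2 hε f) := by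
  rw [LinearPMap.mem_graph_iff]
  constructor
  · rintro ⟨⟨_, f, rfl⟩, h1, h2⟩
    exact ⟨f, Prod.ext h1.symm (h2.symm.trans (opL_apply hε f))⟩
  · rintro ⟨f, rfl⟩
    exact ⟨⟨toL2 hε f, LinearMap.mem_range_self _ f⟩, rfl, opL_apply hε f⟩

theorem energy_nonneg {ε : ℝ} (hε : 0 < ε) (f : smoothZero) : 0 ≤ energy ε f := by
  obtain ⟨C, hC, h⟩ := exists_norm_toL2_sq_le hε
  exact nonneg_of_mul_nonneg_right ((sq_nonneg _).trans (h f)) hC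

/-- Poincaré combined with Cauchy-Schwarz: `‖f‖² ≤ C ⟨L f, f⟩ ≤ C ‖L f‖ ‖f‖`. -/
theorem exists_norm_toL2_le {ε : ℝ} (hε : 0 < ε) :
    ∃ C, ∀ f : smoothZero, ‖toL2 hε f‖ ≤ C * ‖slL2 hε f‖ := by
  obtain ⟨C, hC, h⟩ := exists_norm_toL2_sq_le hε
  refine ⟨C, fun f => ?_⟩
  have h1 : energy ε f ≤ ‖slL2 hε f‖ * ‖toL2 hε f‖ := by
    have := norm_inner_le_norm (𝕜 := ℂ) (slL2 hε f) (toL2 hε f)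
    rwa [inner_slL2_toL2, Complex.norm_real, Real.norm_of_nonneg (energy_nonneg hε f)] at this
  rcases (norm_nonneg (toL2 hε f)).eq_or_lt with h0 | h0
  · rw [← h0]
    positivity
  · refine le_of_mul_le_mul_right ?_ h0
    calc ‖toL2 hε f‖ * ‖toL2 hε f‖ = ‖toL2 hε f‖ ^ 2 := (sq _).symm
      _ ≤ C * energy ε f := h f
      _ ≤ C * (‖slL2 hε f‖ * ‖toL2 hε f‖) := by gcongr
      _ = _ := by ring

/-- The bounded inverse of `L`. -/
theorem exists_green {ε : ℝ} (hε : 0 < ε) : ∃ G : WeightedL2 ε →L[ℂ] WeightedL2 ε,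
    (∀ f : smoothZero, G (slL2 hε f) = toL2 hε f) ∧ G.IsPositive ∧ ∀ y, G y = 0 → y = 0 := by
  set G := (toL2 hε).extendOfNorm (slL2 hε)
  have hG : ∀ f : smoothZero, G (slL2 hε f) = toL2 hε f :=
    LinearMap.extendOfNorm_eq (denseRange_slL2 hε) (exists_norm_toL2_le hε)
  have hpos : G.IsPositive := by
    rw [ContinuousLinearMap.isPositive_iff_complex]
    intro y
    refine (denseRange_slL2 hε).induction_on
      (p := fun y => ((RCLike.re (inner ℂ (G y) y) : ℝ) : ℂ) = inner ℂ (G y) y ∧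
        0 ≤ RCLike.re (inner ℂ (G y) y)) y ?_ fun f => ?_
    · have hc : Continuous fun y => inner ℂ (G y) y := G.continuous.inner continuous_id
      have hr : Continuous fun y => RCLike.re (inner ℂ (G y) y) := RCLike.continuous_re.comp hc
      exact (isClosed_eq (Complex.continuous_ofReal.comp hr) hc).inter
        (isClosed_le continuous_const hr)
    · have he : inner ℂ (toL2 hε f) (slL2 hε f) = (energy ε f : ℂ) := by
        rw [← inner_conj_symm, inner_slL2_toL2, Complex.conj_ofReal]
      rw [hG, he]
      exact ⟨by simp, by simpa using energy_nonneg hε f⟩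
  refine ⟨G, hG, hpos, fun y hy => ?_⟩
  -- By symmetry the kernel of `G` is orthogonal to its range, which contains every smooth function
  -- vanishing at `0`.
  refine (denseRange_toL2 hε).eq_zero_of_inner_left ℂ fun f => ?_
  rw [← hG]
  have := hpos.isSymmetric y (slL2 hε f)
  simpa [hy] using this.symm

end SturmLiouville

end

theorem mainTheorem11 (ε : ℝ) (hε : 0 < ε) (hε2 : ε < 2) :
    (SturmLiouville.opL hε).IsClosable ∧
    SturmLiouville.spec (SturmLiouville.opL hε).closure ⊆ ((↑) : ℝ → ℂ) '' Set.Ioi 0 ∧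
    ∀ (μ : ℂ) (u : (SturmLiouville.opL hε).closure.domain),
      ‖(u : SturmLiouville.WeightedL2 ε)‖ = 1 →
      (SturmLiouville.opL hε).closure u = μ • (u : SturmLiouville.WeightedL2 ε) →
      ∃ f : SturmLiouville.smoothZero,
        (u : SturmLiouville.WeightedL2 ε) = SturmLiouville.toL2 hε f ∧
        μ = ((∫ x in (0 : ℝ)..1, SturmLiouville.p ε x * ‖deriv (f : ℝ → ℂ) x‖ ^ 2 : ℝ) : ℂ) ∧
        0 < ∫ x in (0 : ℝ)..1, SturmLiouville.p ε x * ‖deriv (f : ℝ → ℂ) x‖ ^ 2 := by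
  obtain ⟨G, hG, hpos, hinj⟩ := SturmLiouville.exists_green hε
  obtain ⟨hcl, hgraph⟩ := SturmLiouville.isClosable_and_mem_closure_graph_iff
    (T := SturmLiouville.opL hε) hinj
    (fun z hz => by
      obtain ⟨f, rfl⟩ := (SturmLiouville.mem_opL_graph_iff hε z).1 hz
      exact (hG f).symm)
    ((SturmLiouville.denseRange_slL2 hε).mono (by
      rintro _ ⟨f, rfl⟩
      exact (SturmLiouville.mem_opL_graph_iff hε _).2 ⟨f, by rw [hG]⟩))
  refine ⟨hcl, fun z hz => ?_, fun μ u hu hμ => ?_⟩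
  · by_contra h
    exact hz (SturmLiouville.mem_resolventSet_of_isUnit hgraph
      (SturmLiouville.isUnit_one_sub_smul_of_isPositive hpos h))
  · have hGu : (u : SturmLiouville.WeightedL2 ε) = G (μ • (u : SturmLiouville.WeightedL2 ε)) :=
      (hgraph _ _).1 (hμ ▸ LinearPMap.mem_graph _ u)
    obtain ⟨f, hf⟩ := SturmLiouville.exists_eq_toL2_of_eq_smul hε hG (hGu.trans (map_smul G _ _))
    -- The eigenvalue equation passes from the closure to `L` itself: `G` sends both sides to `u`,
    -- and it is injective.
    have hslf : SturmLiouville.slL2 hε f = μ • SturmLiouville.toL2 hε f := by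
      refine sub_eq_zero.1 (hinj _ ?_)
      rw [map_sub, hG, ← hf, ← hGu, sub_self]
    have hn : ‖SturmLiouville.toL2 hε f‖ = 1 := by rw [← hf, hu]
    have hE := SturmLiouville.inner_slL2_toL2 hε f
    rw [hslf, inner_smul_left, inner_self_eq_norm_sq_to_K, hn] at hE
    -- The inner product is conjugate-linear in its first argument, so `hE` gives the conjugate of
    -- `μ`.
    have hμE : μ = (SturmLiouville.energy ε f : ℂ) := by
      have := congrArg (starRingEnd ℂ) hE
      simpa using this
    -- Strict positivity: for a unit vector the Poincaré inequality reads `1 ≤ C * energy`.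
    obtain ⟨C, hC, hP⟩ := SturmLiouville.exists_norm_toL2_sq_le hε
    refine ⟨f, hf, hμE, ?_⟩
    have h1 := hP f
    rw [hn, one_pow] at h1
    exact pos_of_mul_pos_right (one_pos.trans_le h1) hC.le
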